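/- Let $A$ be a finite-dimensional algebra over a field $K$; modules are finite-dimensional right modules and $D=\operatorname{Hom}_K(-,K)$. Let $e\in A$ be an idempotent such that $eA$ is a minimal faithful projective-injective right $A$-module. Assume that $A$ is gendo-symmetric, that is, $A$ has dominant dimension at least $2$ and $D(Ae)\cong eA$ as $(eAe,A)$-bimodules. An $A$-module $M$ is Gorenstein projective if $\operatorname{Ext}^i_A(M,A)=0=\operatorname{Ext}^i_A(\operatorname{Tr}M,A)$ for all $i\ge 1$, and Gorenstein injective if $D(M)$ is Gorenstein projective. Let $\mathrm{Gpi}(A)$ be the full subcategory of modules that are both. For a module $X$ put $X^\perp=\{M\mid \operatorname{Ext}^i(X,M)=0\ \forall i\ge 1\}$ and ${}^\perp X=\{M\mid \operatorname{Ext}^i(M,X)=0\ \forall i\ge 1\}$. The algebra $A$ is nearly Gorenstein if the Gorenstein projective modules are exactly those in ${}^\perp A$ and the Gorenstein injective modules are exactly those in $D(A)^\perp$. Regard $Ae$ as a right $eAe$-module, and form ${}^\perp(Ae)$ and $(Ae)^\perp$ in the category of right $eAe$-modules. For a right $eAe$-module $X$ let $G_1(X)=X\otimes_{eAe}eA$ and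 $G_2(X)=\operatorname{Hom}_{eAe}(Ae,X)$, which are right $A$-modules, and let $$\mathcal W=\{X\in{}^\perp(Ae)\cap(Ae)^\perp\mid G_1(X)\cong G_2(X)\}.$$ (1) If $A$ is not selfinjective, then the functor $M\mapsto Me$ restricts to an equivalence of categories $(-)e\colon \mathrm{Gpi}(A)\to\mathcal W$. (2) If $A$ is nearly Gorenstein, then the functor $M\mapsto Me$ restricts to an equivalence of categories $(-)e\colon\mathrm{Gpi}(A)\to(Ae)^\perp$, and $(Ae)^\perp={}^\perp(Ae)={}^\perp(Ae)\cap(Ae)^\perp$. -/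

import Mathlib

open CategoryTheory MulOpposite
open scoped TensorProduct

universe u

namespace GendoSym

noncomputable section

/-! Right modules over a ring `A` are modules over `Aᵐᵒᵖ`, with `m * a` written `op a • m`. -/

/-! ### Subcategories of finitely generated modules -/

section General

variable {R : Type u} [Ring R]

/-- The finitely generated modules `M` with `Ext^i(M, X) = 0` for all `i ≥ 1`. -/
def leftPerp (X : ModuleCat.{u} R) : ObjectProperty (ModuleCat.{u} R) :=
  fun M => Module.Finite R M ∧ ∀ i : ℕ, 1 ≤ i → Subsingleton (Abelian.Ext M X i)

/-- The finitely generated modules `M` with `Ext^i(X, M) = 0` for all `i ≥ 1`. -/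
def rightPerp (X : ModuleCat.{u} R) : ObjectProperty (ModuleCat.{u} R) :=
  fun M => Module.Finite R M ∧ ∀ i : ℕ, 1 ≤ i → Subsingleton (Abelian.Ext X M i)

/-- `f : M → I` is an injective envelope. -/
structure IsInjectiveEnvelope {M I : ModuleCat.{u} R} (f : M →ₗ[R] I) : Prop where
  injective_obj : Module.Injective R I
  injective_map : Function.Injective f
  essential : ∀ N : Submodule R I, N ⊓ LinearMap.range f = ⊥ → N = ⊥

/-- The first `n` terms `I_0, …, I_{n-1}` of a minimal injective resolution of `M` are
projective. -/
def DomDimGE : ℕ → ModuleCat.{u} R → Prop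
  | 0, _ => True
  | n + 1, M => ∃ (I : ModuleCat.{u} R) (f : M →ₗ[R] I), IsInjectiveEnvelope f ∧
      Module.Projective R I ∧ DomDimGE n (ModuleCat.of R (I ⧸ LinearMap.range f))

/-- The dominant dimension of a module. -/
def domDim (M : ModuleCat.{u} R) : ℕ∞ :=
  ⨆ n ∈ {n : ℕ | DomDimGE n M}, (n : ℕ∞)

/-- `X` is a direct summand of `M`. -/
def IsSummand (X M : ModuleCat.{u} R) : Prop :=
  ∃ (i : X →ₗ[R] M) (p : M →ₗ[R] X), p ∘ₗ i = LinearMap.id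

/-- `X` is a minimal faithful projective-injective module: it is finitely generated, projective,
injective and faithful, and it is a direct summand of every finitely generated faithful module. -/
structure IsMinimalFaithfulProjInj (X : ModuleCat.{u} R) : Prop where
  finite : Module.Finite R X
  projective : Module.Projective R X
  injective : Module.Injective R X
  faithful : FaithfulSMul R X
  minimal : ∀ M : ModuleCat.{u} R, Module.Finite R M → FaithfulSMul R M → IsSummand X M

/-- The functor `F` maps `P` into `Q`, and the induced functor between the full subcategories
on `P` and on `Q` is an equivalence of categories. -/
def RestrictsToEquivalence {C D : Type*} [Category* C] [Category* D] (F : C ⥤ D)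
    (P : ObjectProperty C) (Q : ObjectProperty D) : Prop :=
  ∃ h : ∀ M : P.FullSubcategory, Q ((P.ι ⋙ F).obj M), (Q.lift (P.ι ⋙ F) h).IsEquivalence

end General

/-! ### Gorenstein projective modules

The next two definitions are used for the two cases `(R, S) = (Aᵐᵒᵖ, A)` (right modules) and
`(R, S) = (A, Aᵐᵒᵖ)` (left modules), with `T = A` the regular bimodule. -/

section Gorenstein

variable (R S T : Type u) [Ring R] [Ring S] [AddCommGroup T] [Module R T] [Module S T]
  [SMulCommClass R S T]

/-- `Hom_R(f, T) : Hom_R(N, T) → Hom_R(M, T)`, a homomorphism of `S`-modules. -/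
def homDual {M N : ModuleCat.{u} R} (f : M →ₗ[R] N) : (N →ₗ[R] T) →ₗ[S] (M →ₗ[R] T) where
  toFun g := g ∘ₗ f
  map_add' _ _ := rfl
  map_smul' _ _ := rfl

/-- `N` is a transpose of `M`: the cokernel of `Hom(P₀, A) → Hom(P₁, A)`, where
`P₁ → P₀ → M → 0` is a presentation by finitely generated projective modules. It is determined
by `M` up to projective direct summands. -/
def IsTranspose (M : ModuleCat.{u} R) (N : ModuleCat.{u} S) : Prop :=
  ∃ (P₁ P₀ : ModuleCat.{u} R) (f : P₁ →ₗ[R] P₀) (g : P₀ →ₗ[R] M),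
    Module.Finite R P₁ ∧ Module.Projective R P₁ ∧ Module.Finite R P₀ ∧ Module.Projective R P₀ ∧
    Function.Exact f g ∧ Function.Surjective g ∧
    Nonempty (N ≅ ModuleCat.of S ((P₁ →ₗ[R] T) ⧸ LinearMap.range (homDual R S T f)))

/-- `Ext^i(M, A) = 0 = Ext^i(Tr M, A)` for all `i ≥ 1`. -/
def gorensteinProjective : ObjectProperty (ModuleCat.{u} R) :=
  fun M => leftPerp (ModuleCat.of R T) M ∧
    ∃ N : ModuleCat.{u} S, IsTranspose R S T M N ∧ leftPerp (ModuleCat.of S T) N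

end Gorenstein

section Algebra

variable (K A : Type u) [Field K] [Ring A] [Algebra K A]

/-- The Gorenstein projective right `A`-modules. -/
abbrev Gp : ObjectProperty (ModuleCat.{u} Aᵐᵒᵖ) := gorensteinProjective Aᵐᵒᵖ A A

/-! ### The duality `D = Hom_K(-, K)` -/

open scoped ModuleCat in
/-- `D(M) = Hom_K(M, K)` for a left module `M`, a right module by `(f * a)(m) = f (a * m)`. -/
def dualOfLeft (M : ModuleCat.{u} A) : ModuleCat.{u} Aᵐᵒᵖ :=
  letI : Module Aᵐᵒᵖ (M →ₗ[K] K) :=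
    { smul := fun a f => f ∘ₗ Algebra.lsmul K K M a.unop
      one_smul := fun f => by ext m; exact congrArg f (one_smul A m)
      mul_smul := fun a b f => by ext m; exact congrArg f (mul_smul b.unop a.unop m)
      smul_zero := fun _ => rfl
      smul_add := fun _ _ _ => rfl
      add_smul := fun a b f => by
        ext m
        exact (congrArg f (add_smul a.unop b.unop m)).trans (map_add f _ _)
      zero_smul := fun f => by
        ext m
        exact (congrArg f (zero_smul A m)).trans (map_zero f) }
  ModuleCat.of Aᵐᵒᵖ (M →ₗ[K] K)

open scoped ModuleCat in
/-- `D(M) = Hom_K(M, K)` for a right module `M`, a left module by `(a * f)(m) = f (m * a)`. -/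
def dualOfRight (M : ModuleCat.{u} Aᵐᵒᵖ) : ModuleCat.{u} A :=
  letI : Module A (M →ₗ[K] K) :=
    { smul := fun a f => f ∘ₗ Algebra.lsmul K K M (op a)
      one_smul := fun f => by ext m; exact congrArg f (one_smul Aᵐᵒᵖ m)
      mul_smul := fun a b f => by ext m; exact congrArg f (mul_smul (op b) (op a) m)
      smul_zero := fun _ => rfl
      smul_add := fun _ _ _ => rfl
      add_smul := fun a b f => by
        ext m
        exact (congrArg f (add_smul (op a) (op b) m)).trans (map_add f _ _)
      zero_smul := fun f => by
        ext m
        exact (congrArg f (zero_smul Aᵐᵒᵖ m)).trans (map_zero f) }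
  ModuleCat.of A (M →ₗ[K] K)

/-- The Gorenstein injective right `A`-modules: those `M` (finitely generated) for which the left
module `D(M)` is Gorenstein projective. -/
def Gi : ObjectProperty (ModuleCat.{u} Aᵐᵒᵖ) :=
  fun M => Module.Finite Aᵐᵒᵖ M ∧ gorensteinProjective A Aᵐᵒᵖ A (dualOfRight K A M)

/-- The Gorenstein projective-injective right `A`-modules. -/
def Gpi : ObjectProperty (ModuleCat.{u} Aᵐᵒᵖ) := Gp A ⊓ Gi K A

/-- `Gp(A) = ⊥A` and `Gi(A) = D(A)⊥`. -/
structure IsNearlyGorenstein : Prop where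
  left : Gp A = leftPerp (ModuleCat.of Aᵐᵒᵖ A)
  right : Gi K A = rightPerp (dualOfLeft K A (ModuleCat.of A A))

/-- The regular right module is injective. -/
def IsSelfinjective : Prop := Module.Injective Aᵐᵒᵖ A

end Algebra

/-! ### The corner `eAe` and its bimodules -/

section Corner

variable {A : Type u} [Ring A] {e : A} (he : IsIdempotentElem e)

/-- The right module `eA = {x | e * x = x}`. -/
def eA (_ : IsIdempotentElem e) : Submodule Aᵐᵒᵖ A where
  carrier := {x | e * x = x}
  add_mem' {x y} hx hy := by
    change e * (x + y) = x + y
    rw [mul_add, show e * x = x from hx, show e * y = y from hy]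
  zero_mem' := mul_zero e
  smul_mem' a x hx := by
    change e * (x * a.unop) = x * a.unop
    rw [← mul_assoc, show e * x = x from hx]

/-- The left module `Ae = {x | x * e = x}`. -/
def Ae (_ : IsIdempotentElem e) : Submodule A A where
  carrier := {x | x * e = x}
  add_mem' {x y} hx hy := by
    change (x + y) * e = x + y
    rw [add_mul, show x * e = x from hx, show y * e = y from hy]
  zero_mem' := zero_mul e
  smul_mem' a x hx := by
    change a * x * e = a * x
    rw [mul_assoc, show x * e = x from hx]

theorem corner_left (b : he.Corner) : e * b.1 = b.1 :=
  ((Subsemigroup.mem_corner_iff he).mp b.2).1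

theorem corner_right (b : he.Corner) : b.1 * e = b.1 :=
  ((Subsemigroup.mem_corner_iff he).mp b.2).2

/-- `eA` is a left `eAe`-module by multiplication. -/
instance : Module he.Corner (eA he) where
  smul b y := ⟨b.1 * y.1, by
    change e * (b.1 * y.1) = b.1 * y.1
    rw [← mul_assoc, corner_left]⟩
  one_smul y := Subtype.ext y.2
  mul_smul b c y := Subtype.ext (mul_assoc b.1 c.1 y.1)
  smul_zero b := Subtype.ext (mul_zero b.1)
  smul_add b y z := Subtype.ext (mul_add b.1 y.1 z.1)
  add_smul b c y := Subtype.ext (add_mul b.1 c.1 y.1)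
  zero_smul y := Subtype.ext (zero_mul y.1)

/-- `Ae` is a right `eAe`-module by multiplication. -/
instance : Module he.Cornerᵐᵒᵖ (Ae he) where
  smul b y := ⟨y.1 * b.unop.1, by
    change y.1 * b.unop.1 * e = y.1 * b.unop.1
    rw [mul_assoc, corner_right]⟩
  one_smul y := Subtype.ext y.2
  mul_smul b c y := Subtype.ext (mul_assoc y.1 c.unop.1 b.unop.1).symm
  smul_zero b := Subtype.ext (zero_mul b.unop.1)
  smul_add b y z := Subtype.ext (add_mul y.1 z.1 b.unop.1)
  add_smul b c y := Subtype.ext (mul_add y.1 b.unop.1 c.unop.1)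
  zero_smul y := Subtype.ext (mul_zero y.1)

/-- `Ae` as a right `eAe`-module. -/
def AeCorner : ModuleCat.{u} he.Cornerᵐᵒᵖ := ModuleCat.of he.Cornerᵐᵒᵖ (Ae he)

/-- The underlying group of `Me`, where `M` is a right `A`-module. -/
def cornerGroup (_ : IsIdempotentElem e) (M : ModuleCat.{u} Aᵐᵒᵖ) : AddSubgroup M where
  carrier := {m | op e • m = m}
  add_mem' {x y} hx hy := by
    change op e • (x + y) = x + y
    rw [smul_add, show op e • x = x from hx, show op e • y = y from hy]
  zero_mem' := smul_zero _
  neg_mem' {x} hx := by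
    change op e • (-x) = -x
    rw [smul_neg, show op e • x = x from hx]

/-- The right `eAe`-module structure of `Me`. -/
instance (M : ModuleCat.{u} Aᵐᵒᵖ) : Module he.Cornerᵐᵒᵖ (cornerGroup he M) where
  smul b m := ⟨op b.unop.1 • m.1, by
    change op e • op b.unop.1 • m.1 = op b.unop.1 • m.1
    rw [← mul_smul, ← op_mul, corner_right]⟩
  one_smul m := Subtype.ext m.2
  mul_smul b c m := Subtype.ext (mul_smul (op b.unop.1) (op c.unop.1) m.1)
  smul_zero b := Subtype.ext (smul_zero (op b.unop.1))
  smul_add b m n := Subtype.ext (smul_add (op b.unop.1) m.1 n.1)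
  add_smul b c m := Subtype.ext (add_smul (op b.unop.1) (op c.unop.1) m.1)
  zero_smul m := Subtype.ext (zero_smul Aᵐᵒᵖ m.1)

/-- The functor `(-)e` from right `A`-modules to right `eAe`-modules. -/
def cornerFunctor : ModuleCat.{u} Aᵐᵒᵖ ⥤ ModuleCat.{u} he.Cornerᵐᵒᵖ where
  obj M := ModuleCat.of he.Cornerᵐᵒᵖ (cornerGroup he M)
  map {M N} f := ModuleCat.ofHom
    { toFun := fun m => ⟨f.hom m.1, by
        change op e • f.hom m.1 = f.hom m.1
        rw [← map_smul, show op e • m.1 = m.1 from m.2]⟩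
      map_add' := fun m n => Subtype.ext (map_add f.hom m.1 n.1)
      map_smul' := fun b m => Subtype.ext (map_smul f.hom (op b.unop.1) m.1) }

/-- `G₁(X) = X ⊗_{eAe} eA` as a right `A`-module: the quotient of `eA ⊗_ℤ X` by the relations
`(b y) ⊗ x = y ⊗ (x b)` for `b ∈ eAe`. -/
def G₁ (X : ModuleCat.{u} he.Cornerᵐᵒᵖ) : ModuleCat.{u} Aᵐᵒᵖ :=
  ModuleCat.of Aᵐᵒᵖ ((eA he ⊗[ℤ] X) ⧸ Submodule.span Aᵐᵒᵖ
    {t : eA he ⊗[ℤ] X | ∃ (b : he.Corner) (y : eA he) (x : X),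
      t = (b • y) ⊗ₜ[ℤ] x - y ⊗ₜ[ℤ] (op b • x)})

/-- `G₂(X) = Hom_{eAe}(Ae, X)`, a right `A`-module by `(f * a)(y) = f (a * y)`. -/
def G₂ (X : ModuleCat.{u} he.Cornerᵐᵒᵖ) : ModuleCat.{u} Aᵐᵒᵖ :=
  letI : Module Aᵐᵒᵖ (Ae he →ₗ[he.Cornerᵐᵒᵖ] X) :=
    { smul := fun a f =>
        { toFun := fun y => f (a.unop • y)
          map_add' := fun y z => by rw [smul_add, map_add]
          map_smul' := fun b y =>
            (congrArg f (Subtype.ext (mul_assoc a.unop y.1 b.unop.1).symm)).trans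
              (map_smul f b (a.unop • y)) }
      one_smul := fun f => by ext y; exact congrArg f (one_smul A y)
      mul_smul := fun a b f => by ext y; exact congrArg f (mul_smul b.unop a.unop y)
      smul_zero := fun _ => rfl
      smul_add := fun _ _ _ => rfl
      add_smul := fun a b f => by
        ext y
        exact (congrArg f (add_smul a.unop b.unop y)).trans (map_add f _ _)
      zero_smul := fun f => by
        ext y
        exact (congrArg f (zero_smul A y)).trans (map_zero f) }
  ModuleCat.of Aᵐᵒᵖ (Ae he →ₗ[he.Cornerᵐᵒᵖ] X)

/-- `W = {X ∈ ⊥(Ae) ∩ (Ae)⊥ | G₁(X) ≅ G₂(X)}`. -/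
def W : ObjectProperty (ModuleCat.{u} he.Cornerᵐᵒᵖ) :=
  fun X => (leftPerp (AeCorner he) ⊓ rightPerp (AeCorner he)) X ∧ Nonempty (G₁ he X ≅ G₂ he X)

end Corner

/-! ### Gendo-symmetric algebras -/

section Gendo

variable (K : Type u) {A : Type u} [Field K] [Ring A] [Algebra K A] {e : A}

/-- An isomorphism `eA ≅ D(Ae)` of `(eAe, A)`-bimodules, where `D(Ae) = Hom_K(Ae, K)` has
`(f * a)(z) = f (a * z)` for `a ∈ A` and `(b * f)(z) = f (z * b)` for `b ∈ eAe`. -/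
structure BimoduleIso (he : IsIdempotentElem e) where
  toEquiv : eA he ≃ₗ[K] (Ae he →ₗ[K] K)
  map_right : ∀ (y : eA he) (a : A) (z : Ae he), toEquiv (op a • y) z = toEquiv y (a • z)
  map_left : ∀ (b : he.Corner) (y : eA he) (z : Ae he), toEquiv (b • y) z = toEquiv y (op b • z)

variable (A)

/-- `A` has dominant dimension at least two and `eA ≅ D(Ae)` as bimodules, where `eA` is a minimal
faithful projective-injective right module. -/
def IsGendoSymmetric : Prop :=
  2 ≤ domDim (ModuleCat.of Aᵐᵒᵖ A) ∧
    ∃ (e : A) (he : IsIdempotentElem e),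
      IsMinimalFaithfulProjInj (ModuleCat.of Aᵐᵒᵖ (eA he)) ∧ Nonempty (BimoduleIso K he)

end Gendo

end

end GendoSym

/-!
Let `F = (-)e`, with left adjoint `G₁` and right adjoint `G₂`. The bimodule isomorphism `eA ≅ D(Ae)`
amounts to a linear form on `A`, symmetric on `eAe`, which pairs `eA` and `Ae` perfectly. Hence `F`
sends both `A` and `D(A)` to `Ae`, and it is bijective on the maps between any module and a direct
sum of copies of `eA`. Dominant dimension at least two makes it bijective on all maps to `A`, and on
all maps from `D(A)`.

Call `M` good if `F` is bijective on the maps `A → M` and `M → D(A)`, that is, if `M ≅ G₂(Me)` and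
`G₁(Me) ≅ M`. A good module has short exact sequences `0 → M → P → M' → 0` and `0 → M'' → P → M → 0`
with `P` a sum of copies of `eA`, which stay exact under `F`. Comparing extension problems along
them and shifting dimension gives `Ext(M, A) = 0` iff `Ext(Me, Ae) = 0`, and
`Ext(D(A), M) = 0` iff `Ext(Ae, Me) = 0`. The sequences also show that a good `M` with
`Ext(M, A) = 0 = Ext(D(A), M)` lies in `Gpi(A)`; conversely Gorenstein projectives are reflexive,
which makes the modules in `Gpi(A)` good. So `F` identifies `Gpi(A)` with `W`. If `A` is nearly
Gorenstein, a single one of the two Ext conditions forces goodness and then the other condition.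
-/

namespace GendoSym

/-! ### Extensions and dimension shifting -/

section Extension

variable {C : Type*} [Category* C] [Limits.HasZeroMorphisms C]

/-- Every morphism `S.X₁ ⟶ T` extends to `S.X₂`. -/
def Extends (S : ShortComplex C) (T : C) : Prop :=
  ∀ f : S.X₁ ⟶ T, ∃ g : S.X₂ ⟶ T, S.f ≫ g = f

/-- Every morphism `T ⟶ S.X₃` lifts to `S.X₂`. -/
def Lifts (T : C) (S : ShortComplex C) : Prop :=
  ∀ f : T ⟶ S.X₃, ∃ g : T ⟶ S.X₂, g ≫ S.g = f

theorem extends_op_iff {S : ShortComplex C} {T : C} : Extends S.op (.op T) ↔ Lifts T S :=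
  ⟨fun h f => let ⟨g, hg⟩ := h f.op; ⟨g.unop, Quiver.Hom.op_inj hg⟩,
    fun h f => let ⟨g, hg⟩ := h f.unop; ⟨g.op, Quiver.Hom.unop_inj hg⟩⟩

end Extension

section ExtVanishing

variable {C : Type*} [Category* C] [Abelian C] [HasExt C] {T X Y X' Y' : C}

/-- `Ext^i(X, Y) = 0` for `1 ≤ i ≤ n`. -/
def ExtVanishUpTo (n : ℕ) (X Y : C) : Prop :=
  ∀ i : ℕ, 1 ≤ i → i ≤ n → Subsingleton (Abelian.Ext X Y i)

/-- `Ext^i(X, Y) = 0` for all `i ≥ 1`. -/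
def ExtVanish (X Y : C) : Prop :=
  ∀ i : ℕ, 1 ≤ i → Subsingleton (Abelian.Ext X Y i)

theorem extVanish_iff_forall_extVanishUpTo : ExtVanish X Y ↔ ∀ n, ExtVanishUpTo n X Y :=
  ⟨fun h _ i hi _ => h i hi, fun h i hi => h i i hi le_rfl⟩

theorem extVanishUpTo_zero (X Y : C) : ExtVanishUpTo 0 X Y :=
  fun _ hi hi' => absurd (hi.trans hi') Nat.one_pos.not_ge

theorem extVanishUpTo_succ {n : ℕ} : ExtVanishUpTo (n + 1) X Y ↔
    Subsingleton (Abelian.Ext X Y 1) ∧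
      ∀ i, 1 ≤ i → i ≤ n → Subsingleton (Abelian.Ext X Y (i + 1)) := by
  refine ⟨fun h => ⟨h 1 le_rfl (by omega), fun i _ hi => h (i + 1) (by omega) (by omega)⟩,
    fun ⟨h₁, h⟩ i hi hin => ?_⟩
  obtain rfl | hi := hi.eq_or_lt
  · exact h₁
  · obtain ⟨j, rfl⟩ := Nat.exists_eq_add_of_lt hi
    exact h (1 + j) (by omega) (by omega)

theorem extVanish_of_projective (X Y : C) [Projective X] : ExtVanish X Y
  | _ + 1, _ => subsingleton_of_forall_eq 0 fun x => x.eq_zero_of_projective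

theorem extVanish_of_injective (X Y : C) [Injective Y] : ExtVanish X Y
  | _ + 1, _ => subsingleton_of_forall_eq 0 fun x => x.eq_zero_of_injective

theorem ExtVanish.of_iso_left (h : ExtVanish X Y) (φ : X ≅ X') : ExtVanish X' Y := fun i hi =>
  (((Abelian.extFunctor i).mapIso φ.op).app Y).addCommGroupIsoToAddEquiv.subsingleton_congr.2
    (h i hi)

theorem ExtVanish.of_iso_right (h : ExtVanish X Y) (φ : Y ≅ Y') : ExtVanish X Y' := fun i hi =>
  ((Abelian.extFunctorObj X i).mapIso φ).addCommGroupIsoToAddEquiv.subsingleton_congr.1 (h i hi)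

variable {S : ShortComplex C} (hS : S.ShortExact)

include hS

theorem subsingleton_ext_one_left_iff (h : Subsingleton (Abelian.Ext S.X₂ T 1)) :
    Subsingleton (Abelian.Ext S.X₃ T 1) ↔ Extends S T := by
  constructor
  · intro h₃ f
    obtain ⟨x, hx⟩ := Abelian.Ext.contravariant_sequence_exact₁ hS T (Abelian.Ext.mk₀ f)
      (n₁ := 1) rfl (Subsingleton.elim _ _)
    obtain ⟨g, rfl⟩ := (Abelian.Ext.mk₀_bijective _ _).2 x
    rw [Abelian.Ext.mk₀_comp_mk₀] at hx
    exact ⟨g, (Abelian.Ext.mk₀_bijective _ _).1 hx⟩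
  · refine fun hE => subsingleton_of_forall_eq 0 fun x => ?_
    obtain ⟨y, rfl⟩ := Abelian.Ext.contravariant_sequence_exact₃ hS T x
      (Subsingleton.elim _ _) (add_zero 1)
    obtain ⟨f, rfl⟩ := (Abelian.Ext.mk₀_bijective _ _).2 y
    obtain ⟨g, rfl⟩ := hE f
    rw [← Abelian.Ext.mk₀_comp_mk₀, ← Abelian.Ext.comp_assoc_of_second_deg_zero,
      hS.extClass_comp, Abelian.Ext.zero_comp]

theorem subsingleton_ext_succ_left_iff {i : ℕ} (h : Subsingleton (Abelian.Ext S.X₂ T i))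
    (h' : Subsingleton (Abelian.Ext S.X₂ T (i + 1))) :
    Subsingleton (Abelian.Ext S.X₃ T (i + 1)) ↔ Subsingleton (Abelian.Ext S.X₁ T i) := by
  constructor
  · refine fun h₃ => subsingleton_of_forall_eq 0 fun x => ?_
    obtain ⟨y, rfl⟩ := Abelian.Ext.contravariant_sequence_exact₁ hS T x (add_comm 1 i)
      (Subsingleton.elim _ _)
    rw [Subsingleton.elim y 0, Abelian.Ext.comp_zero]
  · refine fun h₁ => subsingleton_of_forall_eq 0 fun x => ?_
    obtain ⟨y, rfl⟩ := Abelian.Ext.contravariant_sequence_exact₃ hS T x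
      (Subsingleton.elim _ _) (add_comm 1 i)
    rw [Subsingleton.elim y 0, Abelian.Ext.comp_zero]

theorem subsingleton_ext_one_right_iff (h : Subsingleton (Abelian.Ext T S.X₂ 1)) :
    Subsingleton (Abelian.Ext T S.X₁ 1) ↔ Lifts T S := by
  constructor
  · intro h₁ f
    obtain ⟨x, hx⟩ := Abelian.Ext.covariant_sequence_exact₃ T hS (Abelian.Ext.mk₀ f)
      (n₁ := 1) rfl (Subsingleton.elim _ _)
    obtain ⟨g, rfl⟩ := (Abelian.Ext.mk₀_bijective _ _).2 x
    rw [Abelian.Ext.mk₀_comp_mk₀] at hx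
    exact ⟨g, (Abelian.Ext.mk₀_bijective _ _).1 hx⟩
  · refine fun hL => subsingleton_of_forall_eq 0 fun x => ?_
    obtain ⟨y, rfl⟩ := Abelian.Ext.covariant_sequence_exact₁ T hS x
      (Subsingleton.elim _ _) (zero_add 1)
    obtain ⟨f, rfl⟩ := (Abelian.Ext.mk₀_bijective _ _).2 y
    obtain ⟨g, rfl⟩ := hL f
    rw [← Abelian.Ext.mk₀_comp_mk₀, Abelian.Ext.comp_assoc_of_second_deg_zero,
      hS.comp_extClass, Abelian.Ext.comp_zero]

theorem subsingleton_ext_succ_right_iff {i : ℕ} (h : Subsingleton (Abelian.Ext T S.X₂ i))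
    (h' : Subsingleton (Abelian.Ext T S.X₂ (i + 1))) :
    Subsingleton (Abelian.Ext T S.X₁ (i + 1)) ↔ Subsingleton (Abelian.Ext T S.X₃ i) := by
  constructor
  · refine fun h₁ => subsingleton_of_forall_eq 0 fun x => ?_
    obtain ⟨y, rfl⟩ := Abelian.Ext.covariant_sequence_exact₃ T hS x rfl (Subsingleton.elim _ _)
    rw [Subsingleton.elim y 0, Abelian.Ext.zero_comp]
  · refine fun h₃ => subsingleton_of_forall_eq 0 fun x => ?_
    obtain ⟨y, rfl⟩ := Abelian.Ext.covariant_sequence_exact₁ T hS x (Subsingleton.elim _ _) rfl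
    rw [Subsingleton.elim y 0, Abelian.Ext.zero_comp]

theorem extVanishUpTo_succ_left_iff (h : ExtVanish S.X₂ T) (n : ℕ) :
    ExtVanishUpTo (n + 1) S.X₃ T ↔ Extends S T ∧ ExtVanishUpTo n S.X₁ T := by
  rw [extVanishUpTo_succ, subsingleton_ext_one_left_iff hS (h 1 le_rfl)]
  exact and_congr_right fun _ => forall₂_congr fun i hi => imp_congr_right fun _ =>
    subsingleton_ext_succ_left_iff hS (h i hi) (h (i + 1) (by omega))

theorem extVanishUpTo_succ_right_iff (h : ExtVanish T S.X₂) (n : ℕ) :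
    ExtVanishUpTo (n + 1) T S.X₁ ↔ Lifts T S ∧ ExtVanishUpTo n T S.X₃ := by
  rw [extVanishUpTo_succ, subsingleton_ext_one_right_iff hS (h 1 le_rfl)]
  exact and_congr_right fun _ => forall₂_congr fun i hi => imp_congr_right fun _ =>
    subsingleton_ext_succ_right_iff hS (h i hi) (h (i + 1) (by omega))

theorem extVanish_left_iff (h : ExtVanish S.X₂ T) :
    ExtVanish S.X₃ T ↔ Extends S T ∧ ExtVanish S.X₁ T := by
  simp only [extVanish_iff_forall_extVanishUpTo, ← forall_and_left,
    ← extVanishUpTo_succ_left_iff hS h]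
  exact ⟨fun H n => H (n + 1), fun H n => n.casesOn (extVanishUpTo_zero _ _) H⟩

theorem extVanish_right_iff (h : ExtVanish T S.X₂) :
    ExtVanish T S.X₁ ↔ Lifts T S ∧ ExtVanish T S.X₃ := by
  simp only [extVanish_iff_forall_extVanishUpTo, ← forall_and_left,
    ← extVanishUpTo_succ_right_iff hS h]
  exact ⟨fun H n => H (n + 1), fun H n => n.casesOn (extVanishUpTo_zero _ _) H⟩

omit hS

theorem extVanish_of_syzygies {P : ObjectProperty C}
    (h : ∀ X, P X → ∃ S : ShortComplex C, S.ShortExact ∧ ExtVanish S.X₂ T ∧ Extends S T ∧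
      P S.X₁ ∧ S.X₃ = X) (hX : P X) : ExtVanish X T := by
  rw [extVanish_iff_forall_extVanishUpTo]
  intro n
  induction n generalizing X with
  | zero => exact extVanishUpTo_zero _ _
  | succ n ih =>
    obtain ⟨S, hS, hS₂, hE, hS₁, rfl⟩ := h X hX
    exact (extVanishUpTo_succ_left_iff hS hS₂ n).2 ⟨hE, ih hS₁⟩

theorem extVanish_of_cosyzygies {P : ObjectProperty C}
    (h : ∀ X, P X → ∃ S : ShortComplex C, S.ShortExact ∧ ExtVanish T S.X₂ ∧ Lifts T S ∧
      P S.X₃ ∧ S.X₁ = X) (hX : P X) : ExtVanish T X := by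
  rw [extVanish_iff_forall_extVanishUpTo]
  intro n
  induction n generalizing X with
  | zero => exact extVanishUpTo_zero _ _
  | succ n ih =>
    obtain ⟨S, hS, hS₂, hL, hS₃, rfl⟩ := h X hX
    exact (extVanishUpTo_succ_right_iff hS hS₂ n).2 ⟨hL, ih hS₃⟩

end ExtVanishing

/-! ### Functors bijective on morphisms -/

section HomBijective

variable {C D : Type*} [Category* C] [Category* D] {F : C ⥤ D} {A X Y Z : C}

variable (F X Y) in
/-- `F` is bijective on the morphisms `X ⟶ Y`. -/
def HomBijective : Prop := Function.Bijective (F.map : (X ⟶ Y) → (F.obj X ⟶ F.obj Y))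

theorem homBijective_op_iff : HomBijective F.op (.op Y) (.op X) ↔ HomBijective F X Y := by
  refine Iff.trans ?_ ((Function.Bijective.of_comp_iff' Quiver.Hom.opEquiv.bijective _).trans
    (Function.Bijective.of_comp_iff _ Quiver.Hom.opEquiv.symm.bijective))
  exact Iff.rfl

theorem HomBijective.retract (h : HomBijective F X Y) (r : Retract Z Y) : HomBijective F X Z := by
  constructor
  · intro f g hfg
    rw [← cancel_mono r.i]
    exact h.1 (by rw [F.map_comp, F.map_comp, hfg])
  · intro k
    obtain ⟨l, hl⟩ := h.2 (k ≫ F.map r.i)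
    exact ⟨l ≫ r.r, by rw [F.map_comp, hl, Category.assoc, ← F.map_comp, r.retract, F.map_id,
      Category.comp_id]⟩

theorem HomBijective.of_isLimit {J : Type*} [Category* J] {G : J ⥤ C} {c : Limits.Cone G}
    (hc : Limits.IsLimit c) (hFc : Limits.IsLimit (F.mapCone c))
    (h : ∀ j, HomBijective F X (G.obj j)) : HomBijective F X c.pt := by
  refine ⟨fun f g hfg => hc.hom_ext fun j => (h j).1 ?_, fun k => ?_⟩
  · rw [F.map_comp, F.map_comp, hfg]
  · choose l hl using fun j => (h j).2 (k ≫ F.map (c.π.app j))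
    refine ⟨hc.lift ⟨X, { app := l, naturality := fun i j φ => (h j).1 ?_ }⟩,
      hFc.hom_ext fun j => ?_⟩
    · change F.map (𝟙 X ≫ l j) = _
      rw [Category.id_comp, hl, F.map_comp, hl, Category.assoc, ← F.map_comp, c.w]
    · exact (F.map_comp _ _).symm.trans ((congrArg F.map (hc.fac _ j)).trans (hl j))

theorem HomBijective.of_isColimit {J : Type*} [Category* J] {G : J ⥤ C} {c : Limits.Cocone G}
    (hc : Limits.IsColimit c) (hFc : Limits.IsColimit (F.mapCocone c))
    (h : ∀ j, HomBijective F (G.obj j) Y) : HomBijective F c.pt Y :=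
  homBijective_op_iff.1 <| of_isLimit (F := F.op) hc.op hFc.op fun j =>
    homBijective_op_iff.2 (h j.unop)

theorem HomBijective.of_iso_left (h : HomBijective F X Y) (i : X ≅ Z) : HomBijective F Z Y :=
  homBijective_op_iff.1 ((homBijective_op_iff.2 h).retract (Retract.ofIso i.op))

theorem HomBijective.epi_of_epi_map (hQ : IsCoseparator Y) (h : HomBijective F X Y) {f : Z ⟶ X}
    [Epi (F.map f)] : Epi f where
  left_cancellation g g' hg := (isCoseparator_def _).1 hQ _ _ fun k => h.1 <| by
    rw [← cancel_epi (F.map f), ← F.map_comp, ← F.map_comp, ← Category.assoc, hg, Category.assoc]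

theorem HomBijective.mono_of_mono_map (hA : IsSeparator X) (h : HomBijective F X Y) {f : Y ⟶ Z}
    [Mono (F.map f)] : Mono f :=
  have : Epi (F.op.map f.op) := inferInstanceAs (Epi (F.map f).op)
  have : Epi f.op := epi_of_epi_map ((isCoseparator_op_iff X).2 hA) (homBijective_op_iff.2 h)
  unop_mono_of_epi f.op

section Adjunction

variable {L R : D ⥤ C}

theorem homBijective_iff_bijective_comp_unit (adj : F ⊣ R) :
    HomBijective F X Y ↔ Function.Bijective fun f : X ⟶ Y => f ≫ adj.unit.app Y := by
  rw [HomBijective, ← Function.Bijective.of_comp_iff' (adj.homEquiv X (F.obj Y)).bijective]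
  refine iff_of_eq (congrArg _ (funext fun f => ?_))
  rw [Function.comp_apply, adj.homEquiv_unit, adj.unit_naturality]

theorem isIso_unit_app_of_homBijective [Balanced C] (adj : F ⊣ R) (hA : IsSeparator A)
    (h : HomBijective F A Y) : IsIso (adj.unit.app Y) :=
  hA.isDetector.def _
    ((Function.bijective_iff_existsUnique _).1 ((homBijective_iff_bijective_comp_unit adj).1 h))

theorem homBijective_of_isIso_unit_app (adj : F ⊣ R) (h : IsIso (adj.unit.app Y)) (X : C) :
    HomBijective F X Y :=
  (homBijective_iff_bijective_comp_unit adj).2 ((isIso_iff_yoneda_map_bijective _).1 h X)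

theorem HomBijective.of_isSeparator [Balanced C] [F.IsLeftAdjoint] (hA : IsSeparator A)
    (h : HomBijective F A Y) (X : C) : HomBijective F X Y :=
  let adj := Adjunction.ofIsLeftAdjoint F
  homBijective_of_isIso_unit_app adj (isIso_unit_app_of_homBijective adj hA h) X

theorem HomBijective.of_isCoseparator [Balanced C] [F.IsRightAdjoint] {Q : C}
    (hQ : IsCoseparator Q) (h : HomBijective F X Q) (Y : C) : HomBijective F X Y :=
  homBijective_op_iff.1
    ((homBijective_op_iff.2 h).of_isSeparator ((isSeparator_op_iff Q).2 hQ) (.op Y))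

theorem isIso_counit_app_of_homBijective [Balanced C] (adj : L ⊣ F) {Q : C}
    (hQ : IsCoseparator Q) (h : HomBijective F X Q) : IsIso (adj.counit.app X) := by
  have := isIso_unit_app_of_homBijective adj.op ((isSeparator_op_iff Q).2 hQ)
    (homBijective_op_iff.2 h)
  exact (isIso_op_iff (adj.counit.app X)).1 this

theorem homBijective_rightAdjoint_obj (adj : F ⊣ R) {Z : D} (h : IsIso (adj.counit.app Z))
    (X : C) : HomBijective F X (R.obj Z) := by
  have : IsIso (adj.unit.app (R.obj Z) ≫ R.map (adj.counit.app Z)) := by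
    rw [adj.right_triangle_components]
    exact IsIso.id _
  exact homBijective_of_isIso_unit_app adj
    (IsIso.of_isIso_comp_right _ (R.map (adj.counit.app Z))) X

theorem homBijective_leftAdjoint_obj (adj : L ⊣ F) {Z : D} (h : IsIso (adj.unit.app Z)) (Y : C) :
    HomBijective F (L.obj Z) Y :=
  homBijective_op_iff.1
    (homBijective_rightAdjoint_obj adj.op ((isIso_op_iff (adj.unit.app Z)).2 h) (.op Y))

theorem injective_map_of_homBijective [Balanced C] (adj : F ⊣ R) [IsIso adj.counit]
    (hA : IsSeparator A) (h : HomBijective F A Y) [Injective Y] : Injective (F.obj Y) :=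
  have := isIso_unit_app_of_homBijective adj hA h
  have := adj.fullyFaithfulROfIsIsoCounit.full
  have := adj.fullyFaithfulROfIsIsoCounit.faithful
  adj.injective_of_map_injective _ (.of_iso (asIso (adj.unit.app Y)) inferInstance)

theorem projective_map_of_homBijective [Balanced C] (adj : L ⊣ F) [IsIso adj.unit] {Q : C}
    (hQ : IsCoseparator Q) (h : HomBijective F X Q) [Projective X] : Projective (F.obj X) :=
  have := isIso_counit_app_of_homBijective adj hQ h
  have := adj.fullyFaithfulLOfIsIsoUnit.full
  have := adj.fullyFaithfulLOfIsIsoUnit.faithful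
  adj.projective_of_map_projective _ (.of_iso (asIso (adj.counit.app X)).symm inferInstance)

end Adjunction

theorem restrictsToEquivalence_of_homBijective {P : ObjectProperty C} {Q : ObjectProperty D}
    (map : ∀ M, P M → Q (F.obj M)) (bij : ∀ M N, P M → P N → HomBijective F M N)
    (essSurj : ∀ X, Q X → ∃ M, P M ∧ Nonempty (F.obj M ≅ X)) : RestrictsToEquivalence F P Q := by
  refine ⟨fun M => map _ M.2, ?_⟩
  have : (Q.lift (P.ι ⋙ F) fun M => map _ M.2).Faithful :=
    ⟨fun {M N f g} hfg => by
      ext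
      exact (bij _ _ M.2 N.2).1 (congrArg (fun k => k.hom) hfg)⟩
  have : (Q.lift (P.ι ⋙ F) fun M => map _ M.2).Full :=
    ⟨fun {M N} f => by
      obtain ⟨g, hg⟩ := (bij _ _ M.2 N.2).2 f.hom
      exact ⟨ObjectProperty.homMk g, by ext; exact hg⟩⟩
  have : (Q.lift (P.ι ⋙ F) fun M => map _ M.2).EssSurj :=
    ⟨fun X => by
      obtain ⟨M, hM, ⟨i⟩⟩ := essSurj X.1 X.2
      exact ⟨⟨M, hM⟩, ⟨Q.isoMk i⟩⟩⟩
  exact { }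

end HomBijective

section ShortComplex

variable {C D : Type*} [Category* C] [Category* D] {F : C ⥤ D}

section

variable [Limits.HasZeroMorphisms C] [Limits.HasZeroMorphisms D] [F.PreservesZeroMorphisms]
  {S : ShortComplex C} {X : C}

instance preservesZeroMorphisms_op : F.op.PreservesZeroMorphisms where
  map_zero X Y := congrArg Quiver.Hom.op (F.map_zero Y.unop X.unop)

theorem HomBijective.extends_map_iff (h₁ : HomBijective F S.X₁ X) (h₂ : HomBijective F S.X₂ X) :
    Extends (S.map F) (F.obj X) ↔ Extends S X := by
  constructor
  · intro h f
    obtain ⟨g', hg⟩ := h (F.map f)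
    obtain ⟨g, rfl⟩ := h₂.2 g'
    exact ⟨g, h₁.1 ((F.map_comp _ _).trans hg)⟩
  · intro h f'
    obtain ⟨f, rfl⟩ := h₁.2 f'
    obtain ⟨g, rfl⟩ := h f
    exact ⟨F.map g, (F.map_comp _ _).symm⟩

theorem HomBijective.lifts_map_iff (h₃ : HomBijective F X S.X₃) (h₂ : HomBijective F X S.X₂) :
    Lifts (F.obj X) (S.map F) ↔ Lifts X S := by
  rw [← extends_op_iff (S := S), ← extends_op_iff]
  exact extends_map_iff (F := F.op) (S := S.op) (homBijective_op_iff.2 h₃)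
    (homBijective_op_iff.2 h₂)

end

variable [Abelian C] {S : ShortComplex C} {A Q X : C}

theorem HomBijective.of_kernel [Limits.HasZeroMorphisms D] [F.PreservesZeroMorphisms]
    [F.PreservesMonomorphisms] (hS : S.Exact) [Mono S.f] (h₂ : HomBijective F X S.X₂)
    (h₃ : HomBijective F X S.X₃) : HomBijective F X S.X₁ := by
  constructor
  · intro f g hfg
    rw [← cancel_mono S.f]
    exact h₂.1 (by rw [F.map_comp, F.map_comp, hfg])
  · intro h
    obtain ⟨k, hk⟩ := h₂.2 (h ≫ F.map S.f)
    have hz : k ≫ S.g = 0 := h₃.1 (by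
      rw [F.map_comp, hk, Category.assoc, ← F.map_comp, S.zero, F.map_zero, F.map_zero,
        Limits.comp_zero])
    refine ⟨hS.lift k hz, ?_⟩
    rw [← cancel_mono (F.map S.f), ← F.map_comp, hS.lift_f, hk]

instance preservesMonomorphisms_op [F.PreservesEpimorphisms] : F.op.PreservesMonomorphisms where
  preserves f _ := inferInstanceAs (Mono (F.map f.unop).op)

theorem HomBijective.of_cokernel [Limits.HasZeroMorphisms D] [F.PreservesZeroMorphisms]
    [F.PreservesEpimorphisms] (hS : S.Exact) [Epi S.g] (h₂ : HomBijective F S.X₂ X)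
    (h₁ : HomBijective F S.X₁ X) : HomBijective F S.X₃ X :=
  have : Mono S.op.f := inferInstanceAs (Mono S.g.op)
  homBijective_op_iff.1
    (of_kernel (F := F.op) hS.op (homBijective_op_iff.2 h₂) (homBijective_op_iff.2 h₁))

end ShortComplex

section DualPair

variable {C D : Type*} [Category* C] [Abelian C] [Category* D]

/-- A projective generator `A` and an injective cogenerator `Q` with isomorphic images under `F`,
such that `F` is bijective on the endomorphisms of `A` and of `Q`. -/
structure DualPair (F : C ⥤ D) (A Q : C) where
  isSeparator : IsSeparator A
  projective : Projective A
  isCoseparator : IsCoseparator Q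
  injective : Injective Q
  homBijective_left : HomBijective F A A
  homBijective_right : HomBijective F Q Q
  iso : F.obj A ≅ F.obj Q

namespace DualPair

variable {F : C ⥤ D} {A Q : C} {S : ShortComplex C} (p : DualPair F A Q)

/-- The dual pair of the opposite functor. -/
def op : DualPair F.op (.op Q) (.op A) where
  isSeparator := (isSeparator_op_iff Q).2 p.isCoseparator
  projective := have := p.injective; inferInstance
  isCoseparator := (isCoseparator_op_iff A).2 p.isSeparator
  injective := have := p.projective; inferInstance
  homBijective_left := homBijective_op_iff.2 p.homBijective_right
  homBijective_right := homBijective_op_iff.2 p.homBijective_left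
  iso := p.iso.op

include p

theorem homBijective_to [F.IsLeftAdjoint] (X : C) : HomBijective F X A :=
  p.homBijective_left.of_isSeparator p.isSeparator X

theorem homBijective_from [F.IsRightAdjoint] (X : C) : HomBijective F Q X :=
  p.homBijective_right.of_isCoseparator p.isCoseparator X

theorem extends_of_homBijective [F.IsLeftAdjoint] [Mono S.f] (h₁ : HomBijective F S.X₁ Q) :
    Extends S A := by
  have := p.injective
  intro c
  obtain ⟨q, hq⟩ := h₁.2 (F.map c ≫ p.iso.hom)
  obtain ⟨a, ha⟩ := (p.homBijective_to S.X₂).2 (F.map (Injective.factorThru q S.f) ≫ p.iso.inv)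
  refine ⟨a, (p.homBijective_to _).1 ?_⟩
  rw [F.map_comp, ha, ← Category.assoc, ← F.map_comp, Injective.comp_factorThru, hq,
    Category.assoc, p.iso.hom_inv_id, Category.comp_id]

theorem lifts_of_homBijective [F.IsRightAdjoint] [Epi S.g] (h₃ : HomBijective F A S.X₃) :
    Lifts Q S :=
  have : Mono S.op.f := inferInstanceAs (Mono S.g.op)
  extends_op_iff.1 (p.op.extends_of_homBijective (homBijective_op_iff.2 h₃))

variable [Abelian D] [F.Additive] [F.IsLeftAdjoint] [F.IsRightAdjoint]

theorem homBijective_syzygy (hS : S.ShortExact) (h₂ : HomBijective F S.X₂ Q)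
    (h₃ : HomBijective F S.X₃ Q) (hE : Extends S A) : HomBijective F S.X₁ Q := by
  have := p.injective
  have := hS.mono_f
  have hFS := hS.map_of_exact F
  have := hFS.epi_g
  constructor
  · refine (injective_iff_map_eq_zero (F.mapAddHom : (S.X₁ ⟶ Q) →+ _)).2 fun k hk => ?_
    have hk : F.map k = 0 := hk
    obtain ⟨d, rfl⟩ : ∃ d, S.f ≫ d = k := ⟨_, Injective.comp_factorThru k S.f⟩
    obtain ⟨t, ht⟩ := h₃.2 (hFS.exact.desc (F.map d) ((F.map_comp _ _).symm.trans hk))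
    have hd : S.g ≫ t = d := h₂.1 (by
      rw [F.map_comp, ht]
      exact hFS.exact.g_desc _ _)
    rw [← hd, ← Category.assoc, S.zero, Limits.zero_comp]
  · intro f
    obtain ⟨c, hc⟩ := (p.homBijective_to _).2 (f ≫ p.iso.inv)
    obtain ⟨c, rfl⟩ := hE c
    obtain ⟨q, hq⟩ := h₂.2 (F.map c ≫ p.iso.hom)
    refine ⟨S.f ≫ q, ?_⟩
    rw [F.map_comp, hq, ← Category.assoc, ← F.map_comp, hc, Category.assoc, p.iso.inv_hom_id,
      Category.comp_id]

theorem homBijective_cosyzygy (hS : S.ShortExact) (h₂ : HomBijective F A S.X₂)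
    (h₁ : HomBijective F A S.X₁) (hL : Lifts Q S) : HomBijective F A S.X₃ :=
  homBijective_op_iff.1 (p.op.homBijective_syzygy hS.op (homBijective_op_iff.2 h₂)
    (homBijective_op_iff.2 h₁) (extends_op_iff.2 hL))

end DualPair

end DualPair

section Approximation

variable {C D : Type*} [Category* C] [Abelian C] [Category* D]

/-- A dual pair together with a class `P` of projective-injective objects, preserved by `F`, which
approximate from both sides the objects of `fin` on which `F` is bijective. -/
structure ApproximableDualPair (F : C ⥤ D) (A Q : C) (fin P : ObjectProperty C) extends
    DualPair F A Q where
  projective_of {X : C} : P X → Projective X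
  injective_of {X : C} : P X → Injective X
  homBijective_of_left {X : C} : P X → HomBijective F A X
  homBijective_of_right {X : C} : P X → HomBijective F X Q
  projective_map {X : C} : P X → Projective (F.obj X)
  injective_map {X : C} : P X → Injective (F.obj X)
  exists_cover {M : C} : fin M → HomBijective F M Q →
    ∃ S : ShortComplex C, S.ShortExact ∧ S.X₃ = M ∧ P S.X₂ ∧ fin S.X₁
  exists_cocover {M : C} : fin M → HomBijective F A M →
    ∃ S : ShortComplex C, S.ShortExact ∧ S.X₁ = M ∧ P S.X₂ ∧ fin S.X₃

variable (F : C ⥤ D) (A Q : C) (fin P : ObjectProperty C)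

/-- The objects of `fin` without extensions to `A` or from `Q` on which `F` is bijective. -/
structure IsBiperpendicular [HasExt C] (M : C) : Prop where
  fin : fin M
  homBijective_left : HomBijective F A M
  homBijective_right : HomBijective F M Q
  extVanish_left : ExtVanish M A
  extVanish_right : ExtVanish Q M

namespace ApproximableDualPair

variable {F A Q fin P} [HasExt C] (p : ApproximableDualPair F A Q fin P)

include p

theorem extVanish_left {X : C} (hX : P X) (T : C) : ExtVanish X T :=
  have := p.projective_of hX
  extVanish_of_projective _ _

theorem extVanish_right {X : C} (hX : P X) (T : C) : ExtVanish T X :=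
  have := p.injective_of hX
  extVanish_of_injective _ _

variable [Abelian D] [F.IsLeftAdjoint] [F.IsRightAdjoint]

theorem extVanish_of_extVanish_right
    (hQ : ∀ M, fin M → ExtVanish Q M → HomBijective F M Q)
    {M : C} (hM : fin M) (hA : HomBijective F A M) (hE : ExtVanish Q M) : ExtVanish M A := by
  refine extVanish_of_syzygies (P := fun M => fin M ∧ HomBijective F A M ∧ ExtVanish Q M) ?_
    ⟨hM, hA, hE⟩
  rintro M ⟨hM, hA, hE⟩
  obtain ⟨S, hS, rfl, hP, hf⟩ := p.exists_cover hM (hQ M hM hE)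
  have := hS.mono_f
  have := hS.epi_g
  have hE' : ExtVanish Q S.X₁ :=
    (extVanish_right_iff hS (p.extVanish_right hP Q)).2 ⟨p.lifts_of_homBijective hA, hE⟩
  exact ⟨S, hS, p.extVanish_left hP A, p.extends_of_homBijective (hQ _ hf hE'),
    ⟨hf, .of_kernel hS.exact (p.homBijective_of_left hP) hA, hE'⟩, rfl⟩

theorem extVanish_of_extVanish_left
    (hA : ∀ M, fin M → ExtVanish M A → HomBijective F A M)
    {M : C} (hM : fin M) (hQ : HomBijective F M Q) (hE : ExtVanish M A) : ExtVanish Q M := by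
  refine extVanish_of_cosyzygies (P := fun M => fin M ∧ HomBijective F M Q ∧ ExtVanish M A) ?_
    ⟨hM, hQ, hE⟩
  rintro M ⟨hM, hQ, hE⟩
  obtain ⟨S, hS, rfl, hP, hf⟩ := p.exists_cocover hM (hA M hM hE)
  have := hS.mono_f
  have := hS.epi_g
  have hE' : ExtVanish S.X₃ A :=
    (extVanish_left_iff hS (p.extVanish_left hP A)).2 ⟨p.extends_of_homBijective hQ, hE⟩
  exact ⟨S, hS, p.extVanish_right hP Q, p.lifts_of_homBijective (hA _ hf hE'),
    ⟨hf, .of_cokernel hS.exact (p.homBijective_of_right hP) hQ, hE'⟩, rfl⟩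

variable [F.Additive]

theorem extVanish_map_left_iff [HasExt D] {M : C} (hM : fin M) (h : HomBijective F M Q) :
    ExtVanish (F.obj M) (F.obj A) ↔ ExtVanish M A := by
  simp only [extVanish_iff_forall_extVanishUpTo]
  refine forall_congr' fun n => ?_
  induction n generalizing M with
  | zero => exact iff_of_true (extVanishUpTo_zero _ _) (extVanishUpTo_zero _ _)
  | succ n ih =>
    obtain ⟨S, hS, rfl, hP, hf⟩ := p.exists_cover hM h
    have := p.projective_map hP
    rw [extVanishUpTo_succ_left_iff hS (p.extVanish_left hP A) n]
    refine (extVanishUpTo_succ_left_iff (hS.map_of_exact F)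
      (extVanish_of_projective (F.obj S.X₂) _) n).trans ?_
    rw [HomBijective.extends_map_iff (p.homBijective_to _) (p.homBijective_to _)]
    exact and_congr_right fun hE =>
      ih hf (p.homBijective_syzygy hS (p.homBijective_of_right hP) h hE)

theorem extVanish_map_right_iff [HasExt D] {M : C} (hM : fin M) (h : HomBijective F A M) :
    ExtVanish (F.obj Q) (F.obj M) ↔ ExtVanish Q M := by
  simp only [extVanish_iff_forall_extVanishUpTo]
  refine forall_congr' fun n => ?_
  induction n generalizing M with
  | zero => exact iff_of_true (extVanishUpTo_zero _ _) (extVanishUpTo_zero _ _)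
  | succ n ih =>
    obtain ⟨S, hS, rfl, hP, hf⟩ := p.exists_cocover hM h
    have := p.injective_map hP
    rw [extVanishUpTo_succ_right_iff hS (p.extVanish_right hP Q) n]
    refine (extVanishUpTo_succ_right_iff (hS.map_of_exact F)
      (extVanish_of_injective _ (F.obj S.X₂)) n).trans ?_
    rw [HomBijective.lifts_map_iff (p.homBijective_from _) (p.homBijective_from _)]
    exact and_congr_right fun hL =>
      ih hf (p.homBijective_cosyzygy hS (p.homBijective_of_left hP) h hL)

theorem exists_syzygy {M : C} (h : IsBiperpendicular F A Q fin M) :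
    ∃ S : ShortComplex C, S.ShortExact ∧ S.X₃ = M ∧ P S.X₂ ∧
      IsBiperpendicular F A Q fin S.X₁ := by
  obtain ⟨S, hS, rfl, hP, hf⟩ := p.exists_cover h.fin h.homBijective_right
  have := hS.mono_f
  have := hS.epi_g
  obtain ⟨hE, hA⟩ := (extVanish_left_iff hS (p.extVanish_left hP A)).1 h.extVanish_left
  refine ⟨S, hS, rfl, hP, hf, .of_kernel hS.exact (p.homBijective_of_left hP) h.homBijective_left,
    p.homBijective_syzygy hS (p.homBijective_of_right hP) h.homBijective_right hE, hA, ?_⟩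
  exact (extVanish_right_iff hS (p.extVanish_right hP Q)).2
    ⟨p.lifts_of_homBijective h.homBijective_left, h.extVanish_right⟩

theorem exists_cosyzygy {M : C} (h : IsBiperpendicular F A Q fin M) :
    ∃ S : ShortComplex C, S.ShortExact ∧ S.X₁ = M ∧ P S.X₂ ∧
      IsBiperpendicular F A Q fin S.X₃ := by
  obtain ⟨S, hS, rfl, hP, hf⟩ := p.exists_cocover h.fin h.homBijective_left
  have := hS.mono_f
  have := hS.epi_g
  obtain ⟨hL, hQ⟩ := (extVanish_right_iff hS (p.extVanish_right hP Q)).1 h.extVanish_right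
  refine ⟨S, hS, rfl, hP, hf,
    p.homBijective_cosyzygy hS (p.homBijective_of_left hP) h.homBijective_left hL,
    .of_cokernel hS.exact (p.homBijective_of_right hP) h.homBijective_right, ?_, hQ⟩
  exact (extVanish_left_iff hS (p.extVanish_left hP A)).2
    ⟨p.extends_of_homBijective h.homBijective_right, h.extVanish_left⟩

end ApproximableDualPair

end Approximation

/-! ### The adjoints of `(-)e` -/

section Regular

variable {A : Type u} [Ring A]

variable (A) in
/-- The regular right module `A`. -/
abbrev regular : ModuleCat.{u} Aᵐᵒᵖ := ModuleCat.of Aᵐᵒᵖ A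

/-- The homomorphism `A → M` with `1 ↦ m`. -/
def fromRegular (M : ModuleCat.{u} Aᵐᵒᵖ) (m : M) : regular A ⟶ M :=
  ModuleCat.ofHom (X := A)
    { toFun := fun a => op a • m
      map_add' := fun a b => by rw [MulOpposite.op_add, add_smul]
      map_smul' := fun r a => mul_smul r (op a) m }

theorem regular_hom_apply {M : ModuleCat.{u} Aᵐᵒᵖ} (f : regular A ⟶ M) (a : A) :
    f.hom a = op a • f.hom (1 : A) :=
  (congrArg f.hom (one_mul a).symm).trans (map_smul f.hom (op a) (1 : A))

theorem isSeparator_regular : IsSeparator (regular A) := by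
  refine (isSeparator_def _).2 fun M N f g h => ?_
  ext m
  have := congrArg (fun k => k.hom (1 : A)) (h (fromRegular M m))
  change f.hom (op (1 : A) • m) = g.hom (op (1 : A) • m) at this
  rwa [op_one, one_smul] at this

end Regular

section Corner

variable {A : Type u} [Ring A] {e : A} {he : IsIdempotentElem e}

instance : (cornerFunctor he).Additive where
  map_add := rfl

/-- An element of `eAe` as an element of the corner ring. -/
def mkCorner (he : IsIdempotentElem e) (b : A) (h : e * b = b) (h' : b * e = b) : he.Corner :=
  ⟨b, (Subsemigroup.mem_corner_iff he).2 ⟨h, h'⟩⟩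

/-- The element `e` of `Ae`. -/
def idemAe (he : IsIdempotentElem e) : Ae he := ⟨e, he.eq⟩

/-- The element `e` of `eA`. -/
def idemEA (he : IsIdempotentElem e) : eA he := ⟨e, he.eq⟩

theorem smul_idemAe (z : Ae he) : z.1 • idemAe he = z := Subtype.ext z.2

theorem smul_idemEA (y : eA he) : op y.1 • idemEA he = y := Subtype.ext y.2

theorem corner_smul_idemAe (b : he.Corner) : b.1 • idemAe he = op b • idemAe he :=
  Subtype.ext ((corner_right he b).trans (corner_left he b).symm)

theorem corner_smul_idemEA (b : he.Corner) : op b.1 • idemEA he = b • idemEA he :=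
  Subtype.ext ((corner_left he b).trans (corner_right he b).symm)

theorem op_smul_op_smul_of_mul_eq {M : Type*} [AddCommGroup M] [Module Aᵐᵒᵖ M] {a b c : A}
    (h : a * b = c) (m : M) : op b • op a • m = op c • m := by
  rw [smul_smul, ← op_mul, h]

variable (he) in
/-- The element `m * z` of `Me`, for `m ∈ M` and `z ∈ Ae`, as a homomorphism in `z`. -/
def smulAe (M : ModuleCat.{u} Aᵐᵒᵖ) (m : M) : Ae he →ₗ[he.Cornerᵐᵒᵖ] cornerGroup he M where
  toFun z := ⟨op z.1 • m, op_smul_op_smul_of_mul_eq z.2 m⟩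
  map_add' z z' := Subtype.ext (add_smul (op z.1) (op z'.1) m)
  map_smul' b z := Subtype.ext (mul_smul (op b.unop.1) (op z.1) m)

theorem smulAe_idemAe {M : ModuleCat.{u} Aᵐᵒᵖ} (m : cornerGroup he M) :
    smulAe he M m.1 (idemAe he) = m :=
  Subtype.ext m.2

end Corner

section CoinducedModule

variable {A : Type u} [Ring A] {e : A} {he : IsIdempotentElem e} {X : ModuleCat.{u} he.Cornerᵐᵒᵖ}

/-- The elements of `G₂(X)` as homomorphisms. -/
def homOfG₂ : G₂ he X ≃+ (Ae he →ₗ[he.Cornerᵐᵒᵖ] X) := AddEquiv.refl _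

theorem homOfG₂_smul (a : Aᵐᵒᵖ) (φ : G₂ he X) (z : Ae he) :
    homOfG₂ (a • φ) z = homOfG₂ φ (a.unop • z) := rfl

theorem G₂_ext {φ ψ : G₂ he X} (h : ∀ z, homOfG₂ φ z = homOfG₂ ψ z) : φ = ψ :=
  LinearMap.ext h

variable (he) in
/-- `Hom_{eAe}(Me, X) ≅ Hom_A(M, G₂(X))`, where `k` corresponds to `m ↦ (z ↦ k(m * z))`. -/
def homEquivG₂ (M : ModuleCat.{u} Aᵐᵒᵖ) (X : ModuleCat.{u} he.Cornerᵐᵒᵖ) :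
    ((cornerFunctor he).obj M ⟶ X) ≃ (M ⟶ G₂ he X) where
  toFun k := ModuleCat.ofHom (Y := G₂ he X)
    { toFun := fun m => homOfG₂.symm (k.hom ∘ₗ smulAe he M m)
      map_add' := fun m m' => G₂_ext fun z => by
        refine Eq.trans (congrArg k.hom ?_) (map_add k.hom (smulAe he M m z) (smulAe he M m' z))
        exact Subtype.ext (smul_add (op z.1) m m')
      map_smul' := fun a m => G₂_ext fun z => congrArg k.hom
        (Subtype.ext (op_smul_op_smul_of_mul_eq (a := a.unop) rfl m)) }
  invFun f := ModuleCat.ofHom (X := cornerGroup he M)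
    { toFun := fun m => homOfG₂ (f.hom m.1) (idemAe he)
      map_add' := fun m m' =>
        congrArg (fun φ => homOfG₂ φ (idemAe he)) (map_add f.hom m.1 m'.1)
      map_smul' := fun b m => by
        refine (congrArg (fun φ => homOfG₂ φ (idemAe he))
          (map_smul f.hom (op b.unop.1) m.1)).trans ?_
        rw [homOfG₂_smul, unop_op, corner_smul_idemAe, map_smul, op_unop, RingHom.id_apply] }
  left_inv k := by
    ext m
    exact congrArg k.hom (smulAe_idemAe m)
  right_inv f := by
    ext m
    refine G₂_ext fun z => ?_
    refine (congrArg (fun φ => homOfG₂ φ (idemAe he)) (map_smul f.hom (op z.1) m)).trans ?_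
    rw [homOfG₂_smul, unop_op, smul_idemAe]
    rfl

variable (he) in
/-- The adjunction `(-)e ⊣ G₂`. -/
def cornerAdjunctionG₂ : cornerFunctor he ⊣
    Adjunction.rightAdjointOfEquiv (homEquivG₂ he) (fun M N X f k => by
      ext m
      exact G₂_ext fun z => congrArg k.hom (Subtype.ext (map_smul f.hom (op z.1) m))) :=
  Adjunction.adjunctionOfEquivRight _ _

instance : (cornerFunctor he).IsLeftAdjoint := (cornerAdjunctionG₂ he).isLeftAdjoint

variable (he) in
/-- The projection `z ↦ e * z` of `Ae` onto `eAe`. -/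
def projAe : Ae he →ₗ[he.Cornerᵐᵒᵖ] he.Corner where
  toFun z := mkCorner he (e * z.1) (by rw [← mul_assoc, he.eq])
    (by rw [mul_assoc, show z.1 * e = z.1 from z.2])
  map_add' z z' := Subtype.ext (mul_add e z.1 z'.1)
  map_smul' b z := Subtype.ext (mul_assoc e z.1 b.unop.1).symm

theorem projAe_smul_idemAe (z : Ae he) : op (projAe he z) • idemAe he = e • z :=
  Subtype.ext (by
    change e * (e * z.1) = e * z.1
    rw [← mul_assoc, he.eq])

theorem homOfG₂_eq_of_mem (φ : cornerGroup he (G₂ he X)) (z : Ae he) :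
    homOfG₂ φ.1 z = op (projAe he z) • homOfG₂ φ.1 (idemAe he) := by
  rw [← map_smul (homOfG₂ φ.1), projAe_smul_idemAe]
  exact congrArg (fun ψ => homOfG₂ ψ z) φ.2.symm

theorem isIso_cornerAdjunctionG₂_counit : IsIso (cornerAdjunctionG₂ he).counit := by
  rw [NatTrans.isIso_iff_isIso_app]
  intro X
  rw [ConcreteCategory.isIso_iff_bijective]
  constructor
  · intro (φ : cornerGroup he (G₂ he X)) (ψ : cornerGroup he (G₂ he X))
      (h : homOfG₂ φ.1 (idemAe he) = homOfG₂ ψ.1 (idemAe he))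
    exact Subtype.ext (G₂_ext fun z =>
      ((homOfG₂_eq_of_mem φ z).trans (h ▸ (homOfG₂_eq_of_mem ψ z).symm)))
  · intro x
    have mem : op e • homOfG₂.symm ((fromRegular X x).hom ∘ₗ projAe he)
        = homOfG₂.symm ((fromRegular X x).hom ∘ₗ projAe he) :=
      G₂_ext fun z => congrArg (fromRegular X x).hom (Subtype.ext (by
        change e * (e * z.1) = e * z.1
        rw [← mul_assoc, he.eq]))
    refine ⟨(⟨_, mem⟩ : cornerGroup he (G₂ he X)), ?_⟩
    change op (projAe he (idemAe he)) • x = x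
    rw [show projAe he (idemAe he) = 1 from Subtype.ext he.eq, op_one, one_smul]

theorem homBijective_G₂ (M : ModuleCat.{u} Aᵐᵒᵖ) (X : ModuleCat.{u} he.Cornerᵐᵒᵖ) :
    HomBijective (cornerFunctor he) M (G₂ he X) :=
  have := isIso_cornerAdjunctionG₂_counit (he := he)
  homBijective_rightAdjoint_obj (cornerAdjunctionG₂ he) inferInstance M

/-- The counit `G₂(X)e ≅ X`. -/
noncomputable def cornerG₂Iso (X : ModuleCat.{u} he.Cornerᵐᵒᵖ) :
    (cornerFunctor he).obj (G₂ he X) ≅ X :=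
  have := isIso_cornerAdjunctionG₂_counit (he := he)
  asIso ((cornerAdjunctionG₂ he).counit.app X)

theorem nonempty_iso_G₂ {M : ModuleCat.{u} Aᵐᵒᵖ}
    (h : HomBijective (cornerFunctor he) (regular A) M) :
    Nonempty (M ≅ G₂ he ((cornerFunctor he).obj M)) :=
  have := isIso_unit_app_of_homBijective (cornerAdjunctionG₂ he) isSeparator_regular h
  ⟨asIso ((cornerAdjunctionG₂ he).unit.app M)⟩

end CoinducedModule

section InducedModule

variable {A : Type u} [Ring A] {e : A} {he : IsIdempotentElem e} {X : ModuleCat.{u} he.Cornerᵐᵒᵖ}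

/-- The class of `y ⊗ x` in `G₁(X)`, as a homomorphism in `x`. -/
def tmulG₁ (y : eA he) : X →+ G₁ he X where
  toFun x := Submodule.Quotient.mk (y ⊗ₜ[ℤ] x)
  map_zero' := congrArg Submodule.Quotient.mk (TensorProduct.tmul_zero X y)
  map_add' x x' := congrArg Submodule.Quotient.mk (TensorProduct.tmul_add y x x')

theorem smul_tmulG₁ (a : Aᵐᵒᵖ) (y : eA he) (x : X) : a • tmulG₁ y x = tmulG₁ (a • y) x := rfl

theorem tmulG₁_corner_smul (b : he.Corner) (y : eA he) (x : X) :
    tmulG₁ (b • y) x = tmulG₁ y (op b • x) :=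
  (Submodule.Quotient.eq _).2 (Submodule.subset_span ⟨b, y, x, rfl⟩)

theorem tmulG₁_eq_smul (y : eA he) (x : X) : tmulG₁ y x = op y.1 • tmulG₁ (idemEA he) x := by
  rw [smul_tmulG₁, smul_idemEA]

theorem tmulG₁_idemEA_smul (b : he.Corner) (x : X) :
    tmulG₁ (idemEA he) (op b • x) = op b.1 • tmulG₁ (idemEA he) x := by
  rw [← tmulG₁_corner_smul, smul_tmulG₁, corner_smul_idemEA]

theorem span_range_tmulG₁ :
    Submodule.span Aᵐᵒᵖ (Set.range (tmulG₁ (idemEA he) : X → G₁ he X)) = ⊤ := by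
  rw [Submodule.eq_top_iff']
  intro t
  obtain ⟨t, rfl⟩ := Submodule.Quotient.mk_surjective _ t
  induction t using TensorProduct.induction_on with
  | zero => exact Submodule.zero_mem _
  | tmul y x =>
    change tmulG₁ y x ∈ _
    rw [tmulG₁_eq_smul]
    exact Submodule.smul_mem _ _ (Submodule.subset_span ⟨x, rfl⟩)
  | add s t hs ht => exact Submodule.add_mem _ hs ht

/-- The homomorphism `G₁(X) → M` with `y ⊗ x ↦ h x * y`. -/
def liftG₁ {M : ModuleCat.{u} Aᵐᵒᵖ} (h : X ⟶ (cornerFunctor he).obj M) : G₁ he X ⟶ M :=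
  let h' : X →+ M := (cornerGroup he M).subtype.comp h.hom.toAddMonoidHom
  ModuleCat.ofHom (X := G₁ he X) (Submodule.liftQ _
    (TensorProduct.AlgebraTensorModule.lift
      { toFun := fun y => ((DistribSMul.toAddMonoidHom M (op y.1)).comp h').toIntLinearMap
        map_add' := fun y y' => by
          ext x
          exact add_smul (op y.1) (op y'.1) (h' x)
        map_smul' := fun a y => by
          ext x
          exact mul_smul a (op y.1) (h' x) })
    (Submodule.span_le.2 (by
      rintro _ ⟨b, y, x, rfl⟩
      refine (map_sub _ _ _).trans (sub_eq_zero.2 ?_)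
      change op (b.1 * y.1) • h' x = op y.1 • h' (op b • x)
      rw [show h' (op b • x) = op b.1 • h' x from congrArg Subtype.val (map_smul h.hom (op b) x),
        op_mul, mul_smul])))

variable (he) in
/-- `Hom_A(G₁(X), M) ≅ Hom_{eAe}(X, Me)`, where `f` corresponds to `x ↦ f(e ⊗ x)`. -/
def homEquivG₁ (X : ModuleCat.{u} he.Cornerᵐᵒᵖ) (M : ModuleCat.{u} Aᵐᵒᵖ) :
    (G₁ he X ⟶ M) ≃ (X ⟶ (cornerFunctor he).obj M) where
  toFun f := ModuleCat.ofHom (Y := cornerGroup he M)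
    { toFun := fun x => ⟨f.hom (tmulG₁ (idemEA he) x), by
        change op e • f.hom (tmulG₁ (idemEA he) x) = _
        rw [← map_smul]
        exact congrArg f.hom (tmulG₁_eq_smul (idemEA he) x).symm⟩
      map_add' := fun x x' => Subtype.ext
        ((congrArg f.hom (map_add (tmulG₁ (idemEA he)) x x')).trans (map_add f.hom _ _))
      map_smul' := fun b x => Subtype.ext
        ((congrArg f.hom (tmulG₁_idemEA_smul b.unop x)).trans (map_smul f.hom (op b.unop.1) _)) }
  invFun := liftG₁
  left_inv f := by
    ext t
    refine LinearMap.congr_fun (LinearMap.ext_on_range span_range_tmulG₁ fun x => ?_) t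
    change op e • f.hom (tmulG₁ (idemEA he) x) = f.hom (tmulG₁ (idemEA he) x)
    rw [← map_smul]
    exact congrArg f.hom (tmulG₁_eq_smul (idemEA he) x).symm
  right_inv h := by
    ext x
    exact (h.hom x : cornerGroup he M).2

variable (he) in
/-- The adjunction `G₁ ⊣ (-)e`. -/
def cornerAdjunctionG₁ :
    Adjunction.leftAdjointOfEquiv (homEquivG₁ he) (fun _ _ _ _ _ => rfl) ⊣ cornerFunctor he :=
  Adjunction.adjunctionOfEquivLeft _ _

instance : (cornerFunctor he).IsRightAdjoint := (cornerAdjunctionG₁ he).isRightAdjoint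

theorem isIso_cornerAdjunctionG₁_unit : IsIso (cornerAdjunctionG₁ he).unit :=
  let triple := Adjunction.Triple.mk (cornerAdjunctionG₁ he) (cornerAdjunctionG₂ he)
  triple.isIso_unit_iff_isIso_counit.2 isIso_cornerAdjunctionG₂_counit

theorem homBijective_G₁ (X : ModuleCat.{u} he.Cornerᵐᵒᵖ) (M : ModuleCat.{u} Aᵐᵒᵖ) :
    HomBijective (cornerFunctor he) (G₁ he X) M :=
  have := isIso_cornerAdjunctionG₁_unit (he := he)
  homBijective_leftAdjoint_obj (cornerAdjunctionG₁ he) inferInstance M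

/-- The inverse of the unit `X ≅ G₁(X)e`. -/
noncomputable def cornerG₁Iso (X : ModuleCat.{u} he.Cornerᵐᵒᵖ) :
    (cornerFunctor he).obj (G₁ he X) ≅ X :=
  have := isIso_cornerAdjunctionG₁_unit (he := he)
  (asIso ((cornerAdjunctionG₁ he).unit.app X)).symm

theorem nonempty_G₁_iso {M Q : ModuleCat.{u} Aᵐᵒᵖ} (hQ : IsCoseparator Q)
    (h : HomBijective (cornerFunctor he) M Q) :
    Nonempty (G₁ he ((cornerFunctor he).obj M) ≅ M) :=
  have := isIso_counit_app_of_homBijective (cornerAdjunctionG₁ he) hQ h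
  ⟨asIso ((cornerAdjunctionG₁ he).counit.app M)⟩

theorem finite_G₁ (X : ModuleCat.{u} he.Cornerᵐᵒᵖ) [Module.Finite he.Cornerᵐᵒᵖ X] :
    Module.Finite Aᵐᵒᵖ (G₁ he X) := by
  obtain ⟨s, hs⟩ := Module.Finite.fg_top (R := he.Cornerᵐᵒᵖ) (M := X)
  refine ⟨(Submodule.fg_def.2 ⟨_, s.finite_toSet.image (tmulG₁ (idemEA he)), ?_⟩)⟩
  rw [eq_top_iff, ← span_range_tmulG₁, Submodule.span_le]
  rintro _ ⟨x, rfl⟩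
  have hx : x ∈ Submodule.span he.Cornerᵐᵒᵖ (s : Set X) := hs ▸ Submodule.mem_top
  induction hx using Submodule.span_induction with
  | mem x hx => exact Submodule.subset_span ⟨x, hx, rfl⟩
  | zero => exact map_zero (tmulG₁ (X := X) (idemEA he)) ▸ Submodule.zero_mem _
  | add x y _ _ hx hy => exact map_add (tmulG₁ (idemEA he)) x y ▸ Submodule.add_mem _ hx hy
  | smul b x _ hx =>
    exact tmulG₁_idemEA_smul b.unop x ▸ Submodule.smul_mem _ (op b.unop.1) hx

end InducedModule

section FiniteCorner

open scoped ModuleCat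

variable (K : Type u) {A : Type u} [Field K] [Ring A] [Algebra K A] {e : A}

theorem finite_of_finite {R : Type u} [Ring R] [Algebra K R] [Module.Finite K R]
    (M : ModuleCat.{u} R) [Module.Finite R M] : Module.Finite K M :=
  Module.Finite.trans R M

variable (he : IsIdempotentElem e)

/-- The corner ring `eAe` as a `K`-algebra. -/
abbrev cornerAlgebra : Algebra K he.Corner :=
  RingHom.toAlgebra'
    { toFun := fun k => mkCorner he (k • e) (by rw [mul_smul_comm, he.eq])
        (by rw [smul_mul_assoc, he.eq])
      map_one' := Subtype.ext (one_smul K e)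
      map_mul' := fun k l => Subtype.ext (by
        change (k * l) • e = (k • e) * (l • e)
        rw [smul_mul_smul_comm, he.eq])
      map_zero' := Subtype.ext (zero_smul K e)
      map_add' := fun k l => Subtype.ext (add_smul k l e) }
    (fun k b => Subtype.ext (by
      change (k • e) * b.1 = b.1 * (k • e)
      rw [smul_mul_assoc, mul_smul_comm, corner_left, corner_right]))

attribute [local instance] cornerAlgebra

variable {he} in
theorem cornerAlgebra_smul_val (k : K) (b : he.Corner) : (k • b).1 = k • b.1 := by
  rw [Algebra.smul_def]
  change (k • e) * b.1 = k • b.1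
  rw [smul_mul_assoc, corner_left]

theorem finite_corner [Module.Finite K A] : Module.Finite K he.Corner :=
  Module.Finite.of_injective
    (⟨⟨Subtype.val, fun _ _ => rfl⟩, cornerAlgebra_smul_val K⟩ : he.Corner →ₗ[K] A)
    Subtype.val_injective

/-- The inclusion `Me → M`. -/
def cornerInclusion (M : ModuleCat.{u} Aᵐᵒᵖ) : (cornerFunctor he).obj M →ₗ[K] M where
  toFun m := (m : cornerGroup he M).1
  map_add' _ _ := rfl
  map_smul' k (m : cornerGroup he M) := by
    change op (k • e) • m.1 = op (algebraMap K A k) • m.1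
    rw [Algebra.smul_def, Algebra.commutes, op_mul, mul_smul, show op e • m.1 = m.1 from m.2]

theorem finite_cornerFunctor [Module.Finite K A] (M : ModuleCat.{u} Aᵐᵒᵖ) [Module.Finite Aᵐᵒᵖ M] :
    Module.Finite he.Cornerᵐᵒᵖ ((cornerFunctor he).obj M) := by
  have := finite_of_finite K M
  have : Module.Finite K ((cornerFunctor he).obj M) :=
    .of_injective (cornerInclusion K he M) Subtype.val_injective
  exact .of_restrictScalars_finite K he.Cornerᵐᵒᵖ _

instance isScalarTower_Ae : IsScalarTower K he.Cornerᵐᵒᵖ (Ae he) where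
  smul_assoc k b z := Subtype.ext (by
    change z.1 * (k • b.unop).1 = k • (z.1 * b.unop.1)
    rw [cornerAlgebra_smul_val, mul_smul_comm])

/-- The inclusion `G₂(X) → Hom_K(Ae, X)`. -/
def linearHomOfG₂ (X : ModuleCat.{u} he.Cornerᵐᵒᵖ) : G₂ he X →ₗ[K] Ae he →ₗ[K] X where
  toFun φ := (homOfG₂ φ).restrictScalars K
  map_add' _ _ := rfl
  map_smul' k φ := LinearMap.ext fun z => by
    change homOfG₂ φ (algebraMap K A k • z) = k • homOfG₂ φ z
    rw [algebraMap_smul]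
    exact map_smul ((homOfG₂ φ).restrictScalars K) k z

theorem finite_G₂ [Module.Finite K A] (X : ModuleCat.{u} he.Cornerᵐᵒᵖ)
    [Module.Finite he.Cornerᵐᵒᵖ X] : Module.Finite Aᵐᵒᵖ (G₂ he X) := by
  have := finite_corner K he
  have := finite_of_finite K X
  have : Module.Finite K (Ae he) := .of_injective ((Ae he).subtype.restrictScalars K)
    Subtype.val_injective
  have : Module.Finite K (G₂ he X) := .of_injective (linearHomOfG₂ K he X)
    fun φ ψ h => G₂_ext fun z => LinearMap.congr_fun h z
  exact .of_restrictScalars_finite K Aᵐᵒᵖ _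

end FiniteCorner

/-! ### Trace forms -/

section TraceForm

variable {K A : Type u} [Field K] [Ring A] [Algebra K A] {e : A}

/-- The bilinear form `(y, z) ↦ f (y * z)` on `eA × Ae`. -/
def mulPairing (he : IsIdempotentElem e) (f : A →ₗ[K] K) : eA he →ₗ[K] Ae he →ₗ[K] K :=
  ((LinearMap.mul K A).compr₂ f).compl₁₂ ((eA he).subtype.restrictScalars K)
    ((Ae he).subtype.restrictScalars K)

variable (K) in
/-- A linear form on `A`, symmetric on `eAe`, for which `(y, z) ↦ tr (y * z)` is a perfect pairing
between `eA` and `Ae`. -/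
structure TraceForm (he : IsIdempotentElem e) where
  tr : A →ₗ[K] K
  comm : ∀ b c : he.Corner, tr (b.1 * c.1) = tr (c.1 * b.1)
  bijective_mulPairing : Function.Bijective (mulPairing he tr)

variable {he : IsIdempotentElem e}

section Pairing

variable (t : TraceForm K he)

theorem TraceForm.eq_zero_of_forall_eA {y : eA he} (h : ∀ z : Ae he, t.tr (y.1 * z.1) = 0) :
    y = 0 :=
  (injective_iff_map_eq_zero _).1 t.bijective_mulPairing.1 y (LinearMap.ext h)

theorem TraceForm.exists_eA (f : Ae he →ₗ[K] K) :
    ∃ y : eA he, ∀ z : Ae he, t.tr (y.1 * z.1) = f z :=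
  (t.bijective_mulPairing.2 f).imp fun _ h => LinearMap.congr_fun h

variable [Module.Finite K A]

theorem TraceForm.bijective_flip_mulPairing :
    Function.Bijective (mulPairing he t.tr).flip := by
  have : Module.Finite K (Ae he) :=
    .of_injective ((Ae he).subtype.restrictScalars K) Subtype.val_injective
  have : Module.Finite K (eA he) :=
    .of_injective ((eA he).subtype.restrictScalars K) Subtype.val_injective
  have : (mulPairing he t.tr).IsPerfPair := .of_bijective _ t.bijective_mulPairing
  exact LinearMap.IsPerfPair.bijective_right (mulPairing he t.tr)

theorem TraceForm.eq_zero_of_forall_Ae {z : Ae he} (h : ∀ y : eA he, t.tr (y.1 * z.1) = 0) :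
    z = 0 :=
  (injective_iff_map_eq_zero _).1 t.bijective_flip_mulPairing.1 z (LinearMap.ext h)

theorem TraceForm.exists_Ae (f : eA he →ₗ[K] K) :
    ∃ z : Ae he, ∀ y : eA he, t.tr (y.1 * z.1) = f y :=
  (t.bijective_flip_mulPairing.2 f).imp fun _ h => LinearMap.congr_fun h

end Pairing

theorem BimoduleIso.apply_idemEA (β : BimoduleIso K he) (y : eA he) (z : Ae he) :
    β.toEquiv (idemEA he) ((y.1 * z.1) • idemAe he) = β.toEquiv y z := by
  rw [mul_smul, smul_idemAe, ← β.map_right, smul_idemEA]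

theorem BimoduleIso.apply_corner_comm (β : BimoduleIso K he) (b c : he.Corner) :
    β.toEquiv (idemEA he) ((b.1 * c.1) • idemAe he) =
      β.toEquiv (idemEA he) ((c.1 * b.1) • idemAe he) := by
  have comm : op b • (c.1 • idemAe he) = (c.1 * b.1) • idemAe he := Subtype.ext (by
    change c.1 * e * b.1 = c.1 * b.1 * e
    rw [corner_right, mul_assoc, corner_right])
  rw [mul_smul, ← β.map_right, corner_smul_idemEA, β.map_left, comm]

/-- The trace form `a ↦ β (e, a * e)` of a bimodule isomorphism `β : eA ≅ D(Ae)`. -/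
def BimoduleIso.traceForm (β : BimoduleIso K he) : TraceForm K he where
  tr := β.toEquiv (idemEA he) ∘ₗ (LinearMap.toSpanSingleton A (Ae he) (idemAe he)).restrictScalars K
  comm := β.apply_corner_comm
  bijective_mulPairing := by
    convert β.toEquiv.bijective using 1
    ext y z
    exact β.apply_idemEA y z

variable {e' : A} {he' : IsIdempotentElem e'}

theorem eA_hom_apply (φ : eA he →ₗ[Aᵐᵒᵖ] eA he') (y : eA he) :
    (φ y).1 = (φ (idemEA he)).1 * y.1 := by
  conv_lhs => rw [← smul_idemEA y, map_smul]
  rfl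

theorem mul_idem_of_mul_eq {u : eA he} {v : eA he'} (huv : u.1 * v.1 = e) (hvu : v.1 * u.1 = e') :
    u.1 * e' = u.1 := by
  rw [← hvu, ← mul_assoc, huv, u.2]

/-- Transport of a trace form along an isomorphism `eA ≅ e'A`, given as left multiplication by
`v ∈ e'Ae` with inverse the left multiplication by `u ∈ eAe'`. -/
def TraceForm.conj (t : TraceForm K he') {u : eA he} {v : eA he'} (huv : u.1 * v.1 = e)
    (hvu : v.1 * u.1 = e') : TraceForm K he where
  tr := t.tr ∘ₗ LinearMap.mulLeft K v.1 ∘ₗ LinearMap.mulRight K u.1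
  comm b c := by
    let conj (b : he.Corner) : he'.Corner := mkCorner he' (v.1 * (b.1 * u.1))
      (by rw [← mul_assoc, v.2]) (by rw [mul_assoc, mul_assoc, mul_idem_of_mul_eq huv hvu])
    have conj_mul (b c : he.Corner) : v.1 * (b.1 * c.1 * u.1) = (conj b).1 * (conj c).1 := by
      change _ = v.1 * (b.1 * u.1) * (v.1 * (c.1 * u.1))
      have : b.1 * (u.1 * v.1) = b.1 := by rw [huv, corner_right]
      conv_lhs => rw [← this]
      simp only [mul_assoc]
    change t.tr (v.1 * (b.1 * c.1 * u.1)) = t.tr (v.1 * (c.1 * b.1 * u.1))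
    rw [conj_mul, conj_mul, t.comm]
  bijective_mulPairing := by
    let v' : Ae he := ⟨v.1, mul_idem_of_mul_eq hvu huv⟩
    constructor
    · refine (injective_iff_map_eq_zero _).2 fun y hy => ?_
      have hvy : op y.1 • v = 0 := t.eq_zero_of_forall_eA fun z => by
        have : t.tr (v.1 * (y.1 * (z.1 * v.1) * u.1)) = 0 := LinearMap.congr_fun hy (z.1 • v')
        rwa [mul_assoc, mul_assoc, hvu, z.2, ← mul_assoc] at this
      have : u.1 * (v.1 * y.1) = u.1 * 0 := congrArg (u.1 * ·) (congrArg Subtype.val hvy)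
      rw [← mul_assoc, huv, y.2, mul_zero] at this
      exact Subtype.ext this
    · intro f
      obtain ⟨y, hy⟩ := t.exists_eA (f ∘ₗ (LinearMap.toSpanSingleton A (Ae he) v').restrictScalars K
        ∘ₗ (Ae he').subtype.restrictScalars K)
      refine ⟨op y.1 • u, LinearMap.ext fun z => ?_⟩
      let zu : Ae he' := z.1 • ⟨u.1, mul_idem_of_mul_eq huv hvu⟩
      have hzu : zu.1 • v' = z := Subtype.ext (by
        change z.1 * u.1 * v.1 = z.1
        rw [mul_assoc, huv, z.2])
      have eq : v.1 * (u.1 * y.1 * z.1 * u.1) = y.1 * (z.1 * u.1) := by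
        rw [mul_assoc u.1, mul_assoc u.1, ← mul_assoc v.1, hvu, ← mul_assoc, ← mul_assoc, y.2,
          mul_assoc]
      exact (congrArg t.tr eq).trans ((hy zu).trans (congrArg f hzu))

theorem exists_mul_eq_of_equiv (φ : eA he ≃ₗ[Aᵐᵒᵖ] eA he') :
    ∃ (u : eA he) (v : eA he'), u.1 * v.1 = e ∧ v.1 * u.1 = e' := by
  refine ⟨φ.symm (idemEA he'), φ (idemEA he), ?_, ?_⟩
  · exact (eA_hom_apply φ.symm.toLinearMap _).symm.trans
      (congrArg Subtype.val (φ.symm_apply_apply (idemEA he)))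
  · exact (eA_hom_apply φ.toLinearMap _).symm.trans
      (congrArg Subtype.val (φ.apply_symm_apply (idemEA he')))

theorem nonempty_equiv_of_minimal [Module.Finite K A]
    (h : IsMinimalFaithfulProjInj (ModuleCat.of Aᵐᵒᵖ (eA he)))
    (h' : IsMinimalFaithfulProjInj (ModuleCat.of Aᵐᵒᵖ (eA he'))) :
    Nonempty (eA he ≃ₗ[Aᵐᵒᵖ] eA he') := by
  have finite {e : A} (he : IsIdempotentElem e) : Module.Finite K (eA he) :=
    .of_injective ((eA he).subtype.restrictScalars K) Subtype.val_injective
  have := finite he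
  have := finite he'
  obtain ⟨i, p, hi⟩ := h.minimal _ h'.finite h'.faithful
  obtain ⟨i', p', hi'⟩ := h'.minimal _ h.finite h.faithful
  have inj : Function.Injective i := Function.LeftInverse.injective (LinearMap.congr_fun hi)
  have inj' : Function.Injective i' := Function.LeftInverse.injective (LinearMap.congr_fun hi')
  have finrank_eq : Module.finrank K (eA he) = Module.finrank K (eA he') :=
    le_antisymm (LinearMap.finrank_le_finrank_of_injective (f := i.restrictScalars K) inj)
      (LinearMap.finrank_le_finrank_of_injective (f := i'.restrictScalars K) inj')
  have surj : Function.Surjective (i.restrictScalars K) :=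
    (LinearMap.injective_iff_surjective_of_finrank_eq_finrank finrank_eq).1 inj
  exact ⟨LinearEquiv.ofBijective i ⟨inj, surj⟩⟩

theorem exists_traceForm [Module.Finite K A] (hA : IsGendoSymmetric K A)
    (h : IsMinimalFaithfulProjInj (ModuleCat.of Aᵐᵒᵖ (eA he))) : Nonempty (TraceForm K he) := by
  obtain ⟨-, e', he', h', ⟨β⟩⟩ := hA
  obtain ⟨φ⟩ := nonempty_equiv_of_minimal (K := K) h h'
  obtain ⟨u, v, huv, hvu⟩ := exists_mul_eq_of_equiv φ
  exact ⟨β.traceForm.conj huv hvu⟩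

end TraceForm

section ProjectiveInjective

open scoped ModuleCat

section FromEA

variable {A : Type u} [Ring A] {e : A} {he : IsIdempotentElem e}

/-- The homomorphism `eA → M` with `y ↦ m * y`. -/
def fromEA (M : ModuleCat.{u} Aᵐᵒᵖ) (m : M) : ModuleCat.of Aᵐᵒᵖ (eA he) ⟶ M :=
  ModuleCat.ofHom ((fromRegular M m).hom ∘ₗ (eA he).subtype)

theorem homBijective_from_eA (M : ModuleCat.{u} Aᵐᵒᵖ) :
    HomBijective (cornerFunctor he) (ModuleCat.of Aᵐᵒᵖ (eA he)) M := by
  let E := ModuleCat.of Aᵐᵒᵖ (eA he)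
  let e' : (cornerFunctor he).obj E := (⟨idemEA he, Subtype.ext he.eq⟩ : cornerGroup he E)
  constructor
  · intro f g hfg
    have h : f.hom (idemEA he) = g.hom (idemEA he) :=
      congrArg (fun k => (k.hom e' : cornerGroup he M).1) hfg
    ext y
    rw [← smul_idemEA y, map_smul, map_smul, h]
  · intro k
    refine ⟨fromEA M (k.hom e' : cornerGroup he M).1, ?_⟩
    ext (y : cornerGroup he E)
    let b : he.Corner := mkCorner he y.1.1 y.1.2 (congrArg Subtype.val y.2)
    have hy : op b • e' = y := Subtype.ext (smul_idemEA y.1)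
    exact (map_smul k.hom (op b) e').symm.trans (congrArg k.hom hy)

end FromEA

variable {K A : Type u} [Field K] [Ring A] [Algebra K A] {e : A} {he : IsIdempotentElem e}

section

attribute [local instance] cornerAlgebra

/-- The `K`-linear composition of `Ae → Me ⊆ M → A`, for a homomorphism of right `eAe`-modules
followed by one of right `A`-modules. -/
def linearMapOfHomAe {M : ModuleCat.{u} Aᵐᵒᵖ} (κ : Ae he →ₗ[he.Cornerᵐᵒᵖ] (cornerFunctor he).obj M)
    (φ : M →ₗ[Aᵐᵒᵖ] A) : Ae he →ₗ[K] A :=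
  φ.restrictScalars K ∘ₗ cornerInclusion K he M ∘ₗ κ.restrictScalars K

end

theorem TraceForm.exists_eA_of_hom_Ae (t : TraceForm K he)
    (κ : Ae he →ₗ[he.Cornerᵐᵒᵖ] (cornerFunctor he).obj (ModuleCat.of Aᵐᵒᵖ (eA he))) :
    ∃ y : eA he, ∀ z : Ae he,
      op z.1 • y = (κ z : cornerGroup he (ModuleCat.of Aᵐᵒᵖ (eA he))).1 := by
  obtain ⟨y, hy⟩ := t.exists_eA (t.tr ∘ₗ linearMapOfHomAe κ (eA he).subtype)
  let κ' (z : Ae he) : cornerGroup he (ModuleCat.of Aᵐᵒᵖ (eA he)) := κ z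
  refine ⟨y, fun z => sub_eq_zero.1 ?_⟩
  refine t.eq_zero_of_forall_eA (y := op z.1 • y - (κ' z).1) fun w => ?_
  let b : he.Corner := projAe he w
  have κ_smul : (κ' (op b • z)).1.1 = (κ' z).1.1 * w.1 := by
    have mul_idem : (κ' z).1.1 * e = (κ' z).1.1 := congrArg Subtype.val (κ' z).2
    refine (congrArg (fun m : cornerGroup he (ModuleCat.of Aᵐᵒᵖ (eA he)) => m.1.1)
      (map_smul κ (op b) z)).trans ?_
    change (κ' z).1.1 * (e * w.1) = _
    rw [← mul_assoc, mul_idem]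
  change t.tr ((y.1 * z.1 - (κ' z).1.1) * w.1) = 0
  rw [sub_mul, map_sub, ← κ_smul]
  refine sub_eq_zero.2 (Eq.trans (congrArg t.tr ?_) (hy (op b • z)))
  change _ = y.1 * (z.1 * (e * w.1))
  rw [mul_assoc, ← mul_assoc z.1, z.2]

theorem TraceForm.isIso_cornerAdjunctionG₂_unit_app (t : TraceForm K he) :
    IsIso ((cornerAdjunctionG₂ he).unit.app (ModuleCat.of Aᵐᵒᵖ (eA he))) := by
  refine (ConcreteCategory.isIso_iff_bijective _).2 ⟨(injective_iff_map_eq_zero _).2 ?_, ?_⟩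
  · intro (y : eA he) hy
    refine t.eq_zero_of_forall_eA fun z => ?_
    have : op z.1 • y = 0 := congrArg (fun κ => (homOfG₂ κ z : cornerGroup he _).1) hy
    exact (congrArg (fun x : eA he => t.tr x.1) this).trans (map_zero t.tr)
  · intro κ
    obtain ⟨y, hy⟩ := t.exists_eA_of_hom_Ae (homOfG₂ κ)
    exact ⟨y, G₂_ext fun z => Subtype.ext (hy z)⟩

theorem TraceForm.homBijective_to_eA (t : TraceForm K he) (M : ModuleCat.{u} Aᵐᵒᵖ) :
    HomBijective (cornerFunctor he) M (ModuleCat.of Aᵐᵒᵖ (eA he)) :=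
  homBijective_of_isIso_unit_app _ t.isIso_cornerAdjunctionG₂_unit_app M

variable [FaithfulSMul Aᵐᵒᵖ (eA he)]

theorem eq_zero_of_forall_hom_eA {P : ModuleCat.{u} Aᵐᵒᵖ} [Module.Projective Aᵐᵒᵖ P] {x : P}
    (h : ∀ f : P →ₗ[Aᵐᵒᵖ] eA he, f x = 0) : x = 0 := by
  obtain ⟨s, hs⟩ := ‹Module.Projective Aᵐᵒᵖ P›
  suffices s x = 0 by rw [← hs x, this, map_zero]
  ext i : 1
  refine FaithfulSMul.eq_of_smul_eq_smul (α := eA he) fun y => ?_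
  rw [Finsupp.zero_apply, zero_smul]
  exact h (LinearMap.toSpanSingleton Aᵐᵒᵖ (eA he) y ∘ₗ Finsupp.lapply i ∘ₗ s)

theorem TraceForm.homBijective_of_projective_of_injective (t : TraceForm K he)
    (M I : ModuleCat.{u} Aᵐᵒᵖ) [Module.Projective Aᵐᵒᵖ I] [Module.Injective Aᵐᵒᵖ I] :
    HomBijective (cornerFunctor he) M I := by
  let E : ModuleCat.{u} Aᵐᵒᵖ := ModuleCat.of Aᵐᵒᵖ (eA he)
  have : Injective I := (Module.injective_iff_injective_object _ _).1 inferInstance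
  let j : I ⟶ ∏ᶜ fun _ : I ⟶ E => E := Limits.Pi.lift fun f => f
  have : Mono j := (ModuleCat.mono_iff_injective j).2 <| (injective_iff_map_eq_zero _).2
    fun x hx => eq_zero_of_forall_hom_eA (he := he) fun f => by
      have : j ≫ Limits.Pi.π (fun _ : I ⟶ E => E) (ModuleCat.ofHom f) = ModuleCat.ofHom f :=
        Limits.Pi.lift_π _ _
      rw [← ModuleCat.hom_ofHom f, ← this, ModuleCat.hom_comp, LinearMap.comp_apply]
      exact (congrArg _ hx).trans (map_zero _)
  have hprod : HomBijective (cornerFunctor he) M (∏ᶜ fun _ : I ⟶ E => E) := by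
    have := (cornerAdjunctionG₁ he).isRightAdjoint
    exact .of_isLimit (Limits.limit.isLimit _)
      (Limits.isLimitOfPreserves (cornerFunctor he) (Limits.limit.isLimit _))
      fun _ => t.homBijective_to_eA M
  exact hprod.retract ⟨j, Injective.factorThru (𝟙 I) j, Injective.comp_factorThru _ _⟩

theorem exists_domDimGE {R : Type u} [Ring R] {M : ModuleCat.{u} R} (h : 2 ≤ domDim M) :
    ∃ n, DomDimGE (n + 2) M := by
  by_contra! hc
  have : domDim M ≤ 1 := iSup₂_le fun n hn => by
    rcases n with _ | _ | n
    · exact zero_le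
    · exact le_rfl
    · exact (hc n hn).elim
  exact absurd (h.trans this) (by decide)

theorem TraceForm.homBijective_of_domDim (t : TraceForm K he) (M N : ModuleCat.{u} Aᵐᵒᵖ)
    (hN : 2 ≤ domDim N) : HomBijective (cornerFunctor he) M N := by
  obtain ⟨n, I, f, hI, hI', J, g, hJ, hJ', -⟩ := exists_domDimGE hN
  have := hI.injective_obj
  have := hJ.injective_obj
  let q : I ⟶ J := ModuleCat.ofHom (g ∘ₗ (LinearMap.range f).mkQ)
  have exact_f_q : Function.Exact f q.hom := fun x =>
    (map_eq_zero_iff g hJ.injective_map).trans (Submodule.Quotient.mk_eq_zero _)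
  let S : ShortComplex (ModuleCat.{u} Aᵐᵒᵖ) := .mk (ModuleCat.ofHom f) q <| by
    ext x : 2
    exact exact_f_q.apply_apply_eq_zero x
  have : Mono S.f := (ModuleCat.mono_iff_injective _).2 hI.injective_map
  have hS : S.Exact := (ShortComplex.ShortExact.moduleCat_exact_iff_function_exact _).2 exact_f_q
  exact .of_kernel hS (t.homBijective_of_projective_of_injective M I)
    (t.homBijective_of_projective_of_injective M J)

end ProjectiveInjective

/-! ### The duality `D` -/

section Duality

open scoped ModuleCat

section

variable {K V V' V'' : Type*} [Field K] [AddCommGroup V] [AddCommGroup V'] [AddCommGroup V'']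
  [Module K V] [Module K V'] [Module K V'']

theorem exact_dualMap {f : V →ₗ[K] V'} {g : V' →ₗ[K] V''} (h : Function.Exact f g) :
    Function.Exact g.dualMap f.dualMap := by
  rw [LinearMap.exact_iff] at h ⊢
  rw [LinearMap.ker_dualMap_eq_dualAnnihilator_range,
    LinearMap.range_dualMap_eq_dualAnnihilator_ker, h]

end

variable (K A : Type u) [Field K] [Ring A] [Algebra K A]

/-- The identification of `D(N)` with the linear forms on a left module `N`. -/
def formOfLeft (N : ModuleCat.{u} A) : dualOfLeft K A N ≃ₗ[K] (N →ₗ[K] K) where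
  toFun q := q
  invFun q := q
  map_add' _ _ := rfl
  map_smul' k q := by
    rw [← algebraMap_smul Aᵐᵒᵖ k q]
    ext n
    refine Eq.trans ?_ (map_smul (show Module.Dual K N from q) k n)
    exact congrArg (show Module.Dual K N from q) (algebraMap_smul A k n)

/-- The identification of `D(M)` with the linear forms on a right module `M`. -/
def formOfRight (M : ModuleCat.{u} Aᵐᵒᵖ) : dualOfRight K A M ≃ₗ[K] (M →ₗ[K] K) where
  toFun q := q
  invFun q := q
  map_add' _ _ := rfl
  map_smul' k q := by
    rw [← algebraMap_smul A k q]
    ext m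
    refine Eq.trans ?_ (map_smul (show Module.Dual K M from q) k m)
    exact congrArg (show Module.Dual K M from q) (algebraMap_smul Aᵐᵒᵖ k m)

/-- The duality `D` from left modules to right modules. -/
def dualOfLeftFunctor : (ModuleCat.{u} A)ᵒᵖ ⥤ ModuleCat.{u} Aᵐᵒᵖ where
  obj N := dualOfLeft K A N.unop
  map {N N'} f := ModuleCat.ofHom (X := dualOfLeft K A N.unop) (Y := dualOfLeft K A N'.unop)
    { toFun := (f.unop.hom.restrictScalars K).dualMap
      map_add' := map_add _
      map_smul' := fun a q => LinearMap.ext fun n =>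
        congrArg (formOfLeft K A _ q) (map_smul f.unop.hom a.unop n).symm }

/-- The duality `D` from right modules to left modules. -/
def dualOfRightFunctor : (ModuleCat.{u} Aᵐᵒᵖ)ᵒᵖ ⥤ ModuleCat.{u} A where
  obj M := dualOfRight K A M.unop
  map {M M'} f := ModuleCat.ofHom (X := dualOfRight K A M.unop) (Y := dualOfRight K A M'.unop)
    { toFun := (f.unop.hom.restrictScalars K).dualMap
      map_add' := map_add _
      map_smul' := fun a q => LinearMap.ext fun m =>
        congrArg (formOfRight K A _ q) (map_smul f.unop.hom (op a) m).symm }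

variable {A}

/-- A homomorphism `N → D(M)` as a homomorphism `M → D(N)`. -/
def flipOfLeft {N : ModuleCat.{u} A} {M : ModuleCat.{u} Aᵐᵒᵖ} (g : N ⟶ dualOfRight K A M) :
    M ⟶ dualOfLeft K A N :=
  ModuleCat.ofHom (Y := dualOfLeft K A N)
    { toFun := ((formOfRight K A M).toLinearMap ∘ₗ g.hom.restrictScalars K).flip
      map_add' := map_add _
      map_smul' := fun a m => LinearMap.ext fun n =>
        (congrArg (fun q => formOfRight K A M q m) (map_smul g.hom a.unop n)).symm }

/-- A homomorphism `M → D(N)` as a homomorphism `N → D(M)`. -/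
def flipOfRight {N : ModuleCat.{u} A} {M : ModuleCat.{u} Aᵐᵒᵖ} (g : M ⟶ dualOfLeft K A N) :
    N ⟶ dualOfRight K A M :=
  ModuleCat.ofHom (Y := dualOfRight K A M)
    { toFun := ((formOfLeft K A N).toLinearMap ∘ₗ g.hom.restrictScalars K).flip
      map_add' := map_add _
      map_smul' := fun a n => LinearMap.ext fun m =>
        (congrArg (fun q => formOfLeft K A N q n) (map_smul g.hom (op a) m)).symm }

variable (A) in
/-- The two dualities are adjoint on the right: `Hom(M, D(N)) ≃ Hom(N, D(M))`. -/
def dualAdjunction : (dualOfLeftFunctor K A).rightOp ⊣ dualOfRightFunctor K A :=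
  Adjunction.mkOfHomEquiv
    { homEquiv := fun N M =>
        { toFun := fun g => flipOfRight K g.unop
          invFun := fun g => (flipOfLeft K g).op
          left_inv := fun _ => rfl
          right_inv := fun _ => rfl } }

instance : (dualOfLeftFunctor K A).Additive where
  map_add := by
    intro N N' f g
    refine ModuleCat.hom_ext <| LinearMap.ext fun q => LinearMap.ext fun n => ?_
    exact map_add (formOfLeft K A _ q) _ _

instance : (dualOfRightFunctor K A).Additive where
  map_add := by
    intro N N' f g
    refine ModuleCat.hom_ext <| LinearMap.ext fun q => LinearMap.ext fun n => ?_
    exact map_add (formOfRight K A _ q) _ _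

variable {K}

theorem shortExact_map_dualOfLeftFunctor {S : ShortComplex (ModuleCat.{u} A)}
    (hS : S.ShortExact) : (S.op.map (dualOfLeftFunctor K A)).ShortExact where
  exact := (ShortComplex.ShortExact.moduleCat_exact_iff_function_exact _).2 <|
    exact_dualMap (f := S.f.hom.restrictScalars K) (g := S.g.hom.restrictScalars K)
      ((ShortComplex.ShortExact.moduleCat_exact_iff_function_exact _).1 hS.exact)
  mono_f := (ModuleCat.mono_iff_injective _).2 <|
    LinearMap.dualMap_injective_of_surjective (f := S.g.hom.restrictScalars K)
      ((ModuleCat.epi_iff_surjective S.g).1 hS.epi_g)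
  epi_g := (ModuleCat.epi_iff_surjective _).2 <|
    LinearMap.dualMap_surjective_of_injective (f := S.f.hom.restrictScalars K)
      ((ModuleCat.mono_iff_injective S.f).1 hS.mono_f)

theorem shortExact_map_dualOfRightFunctor {S : ShortComplex (ModuleCat.{u} Aᵐᵒᵖ)}
    (hS : S.ShortExact) : (S.op.map (dualOfRightFunctor K A)).ShortExact where
  exact := (ShortComplex.ShortExact.moduleCat_exact_iff_function_exact _).2 <|
    exact_dualMap (f := S.f.hom.restrictScalars K) (g := S.g.hom.restrictScalars K)
      ((ShortComplex.ShortExact.moduleCat_exact_iff_function_exact _).1 hS.exact)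
  mono_f := (ModuleCat.mono_iff_injective _).2 <|
    LinearMap.dualMap_injective_of_surjective (f := S.g.hom.restrictScalars K)
      ((ModuleCat.epi_iff_surjective S.g).1 hS.epi_g)
  epi_g := (ModuleCat.epi_iff_surjective _).2 <|
    LinearMap.dualMap_surjective_of_injective (f := S.f.hom.restrictScalars K)
      ((ModuleCat.mono_iff_injective S.f).1 hS.mono_f)

instance : (dualOfRightFunctor K A).PreservesEpimorphisms where
  preserves f _ := (ModuleCat.epi_iff_surjective _).2 <|
    LinearMap.dualMap_surjective_of_injective (f := f.unop.hom.restrictScalars K)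
      ((ModuleCat.mono_iff_injective f.unop).1 inferInstance)

instance : (dualOfLeftFunctor K A).rightOp.PreservesMonomorphisms where
  preserves f _ :=
    have : Epi ((dualOfLeftFunctor K A).map f.op) := (ModuleCat.epi_iff_surjective _).2 <|
      LinearMap.dualMap_surjective_of_injective (f := f.hom.restrictScalars K)
        ((ModuleCat.mono_iff_injective f).1 inferInstance)
    op_mono_of_epi _

instance (N : ModuleCat.{u} A) [Projective N] : Injective (dualOfLeft K A N) := by
  have := (dualAdjunction K A).map_projective N inferInstance
  exact inferInstanceAs (Injective ((dualOfLeftFunctor K A).rightOp.obj N).unop)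

section Finite

variable [Module.Finite K A]

theorem finite_dualOfRight (M : ModuleCat.{u} Aᵐᵒᵖ) [Module.Finite Aᵐᵒᵖ M] :
    Module.Finite A (dualOfRight K A M) := by
  have : Module.Finite K M := finite_of_finite K M
  have : Module.Finite K (dualOfRight K A M) := .equiv (formOfRight K A M).symm
  exact .of_restrictScalars_finite K A _

instance isIso_dualAdjunction_counit (M : (ModuleCat.{u} Aᵐᵒᵖ)ᵒᵖ) [Module.Finite Aᵐᵒᵖ M.unop] :
    IsIso ((dualAdjunction K A).counit.app M) := by
  have : Module.Finite K M.unop := finite_of_finite K M.unop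
  let i : M.unop ≃ₗ[K] dualOfLeft K A (dualOfRight K A M.unop) :=
    Module.evalEquiv K M.unop ≪≫ₗ (formOfRight K A M.unop).dualMap ≪≫ₗ (formOfLeft K A _).symm
  have : IsIso ((dualAdjunction K A).counit.app M).unop :=
    (ConcreteCategory.isIso_iff_bijective _).2 i.bijective
  exact (isIso_unop_iff _).1 this

variable (K) in
/-- `M ≅ D(D(M))` for a finitely generated right module `M`. -/
noncomputable def bidualIso (M : ModuleCat.{u} Aᵐᵒᵖ) [Module.Finite Aᵐᵒᵖ M] :
    dualOfLeft K A (dualOfRight K A M) ≅ M :=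
  (asIso ((dualAdjunction K A).counit.app (Opposite.op M))).unop.symm

theorem isIso_dualAdjunction_unit (N : ModuleCat.{u} A) [Module.Finite A N] :
    IsIso ((dualAdjunction K A).unit.app N) := by
  have : Module.Finite K N := finite_of_finite K N
  let i : N ≃ₗ[K] dualOfRight K A (dualOfLeft K A N) :=
    Module.evalEquiv K N ≪≫ₗ (formOfLeft K A N).dualMap ≪≫ₗ (formOfRight K A _).symm
  exact (ConcreteCategory.isIso_iff_bijective _).2 i.bijective

theorem homBijective_dualOfLeftFunctor (N T : ModuleCat.{u} A) [Module.Finite A T] :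
    HomBijective (dualOfLeftFunctor K A).rightOp N T :=
  homBijective_of_isIso_unit_app _ (isIso_dualAdjunction_unit T) N

variable (K) in
theorem extVanish_dualOfLeft_iff (N T : ModuleCat.{u} A) [Module.Finite A T] :
    ExtVanish (dualOfLeft K A T) (dualOfLeft K A N) ↔ ExtVanish N T := by
  simp only [extVanish_iff_forall_extVanishUpTo]
  refine forall_congr' fun n => ?_
  induction n generalizing N with
  | zero => exact iff_of_true (extVanishUpTo_zero _ _) (extVanishUpTo_zero _ _)
  | succ n ih =>
    let S : ShortComplex (ModuleCat.{u} A) := .mk _ _ (Limits.kernel.condition (Projective.π N))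
    have hS : S.ShortExact := { exact := ShortComplex.exact_kernel (Projective.π N) }
    have : Projective S.X₂ := inferInstanceAs (Projective (Projective.over N))
    have : Injective (S.op.map (dualOfLeftFunctor K A)).X₂ :=
      inferInstanceAs (Injective (dualOfLeft K A S.X₂))
    have extends_iff : Lifts (dualOfLeft K A T) (S.op.map (dualOfLeftFunctor K A)) ↔
        Extends S T := by
      refine Iff.trans ?_ ((homBijective_dualOfLeftFunctor (K := K) S.X₁ T).extends_map_iff
        (homBijective_dualOfLeftFunctor S.X₂ T))
      rw [← extends_op_iff]
      rfl
    rw [show N = S.X₃ from rfl, extVanishUpTo_succ_left_iff hS (extVanish_of_projective S.X₂ _),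
      ← ih, ← extends_iff]
    exact extVanishUpTo_succ_right_iff (shortExact_map_dualOfLeftFunctor hS)
      (extVanish_of_injective _ _) n

end Finite

end Duality

section RegularDual

open scoped ModuleCat

variable {K A : Type u} [Field K] [Ring A] [Algebra K A] {e : A} {he : IsIdempotentElem e}

variable (K A) in
/-- The injective cogenerator `D(A)` of the right modules. -/
abbrev regularDual : ModuleCat.{u} Aᵐᵒᵖ := dualOfLeft K A (ModuleCat.of A A)

instance : Projective (regular A) := by
  let i : Aᵐᵒᵖ ≃ₗ[Aᵐᵒᵖ] A := { opAddEquiv.symm with map_smul' := fun _ _ => rfl }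
  exact (IsProjective.iff_projective (R := Aᵐᵒᵖ) A).1 (Module.Projective.of_equiv i)

instance : Injective (regularDual K A) :=
  have : Projective (ModuleCat.of A A) :=
    (IsProjective.iff_projective (R := A) A).1 inferInstance
  inferInstance

theorem isCoseparator_regularDual : IsCoseparator (regularDual K A) := by
  refine (isCoseparator_def _).2 fun M N f g h => ?_
  ext m
  rw [← sub_eq_zero, ← Module.forall_dual_apply_eq_zero_iff K]
  intro φ
  rw [map_sub, sub_eq_zero]
  let k : N ⟶ regularDual K A := flipOfLeft K (N := ModuleCat.of A A)
    (ModuleCat.ofHom (Y := dualOfRight K A N)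
      (LinearMap.toSpanSingleton A _ ((formOfRight K A N).symm φ)))
  have k_one (n : N) : formOfLeft K A _ (k.hom n) (1 : A) = φ n :=
    congrArg φ (one_smul Aᵐᵒᵖ n)
  have := congrArg (fun k => formOfLeft K A (ModuleCat.of A A) (k.hom m) (1 : A)) (h k)
  exact (k_one _).symm.trans (this.trans (k_one _))

theorem formOfLeft_algebraMap_smul {N : ModuleCat.{u} A} (q : dualOfLeft K A N) (k : K) (n : N) :
    formOfLeft K A N q (algebraMap K A k • n) = k * formOfLeft K A N q n := by
  rw [algebraMap_smul, map_smul, smul_eq_mul]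

/-- An additive map on a left module that is linear for the action of `K ⊆ A` as an element of the
dual. -/
def dualOfLeftMk {N : ModuleCat.{u} A} (f : N →+ K)
    (hf : ∀ (k : K) n, f (algebraMap K A k • n) = k * f n) : dualOfLeft K A N :=
  (formOfLeft K A N).symm
    { f with map_smul' := fun k n => by rw [← algebraMap_smul A k n]; exact hf k n }

variable (K A) in
/-- The identification of `D(A)` with the linear forms on `A`. -/
def formOfRegular : regularDual K A ≃+ (A →ₗ[K] K) where
  toFun q :=
    { toFun := formOfLeft K A (ModuleCat.of A A) q
      map_add' := map_add (formOfLeft K A (ModuleCat.of A A) q)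
      map_smul' := fun k a => by
        rw [Algebra.smul_def]
        exact formOfLeft_algebraMap_smul q k a }
  invFun f := dualOfLeftMk (N := ModuleCat.of A A) f.toAddMonoidHom fun k a => by
    refine Eq.trans ?_ (map_smul f k a)
    exact congrArg f (Algebra.smul_def k (show A from a)).symm
  left_inv _ := rfl
  right_inv _ := rfl
  map_add' _ _ := rfl

theorem regularDual_ext {q q' : regularDual K A}
    (h : ∀ a : A, formOfRegular K A q a = formOfRegular K A q' a) : q = q' :=
  (formOfRegular K A).injective (LinearMap.ext h)

variable (K) in
/-- The endomorphism of `D(A)` dual to the right multiplication by `a`. -/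
def dualMulRight (a : A) : regularDual K A ⟶ regularDual K A :=
  (dualOfLeftFunctor K A).map (ModuleCat.ofHom (LinearMap.toSpanSingleton A A a)).op

namespace TraceForm

variable (t : TraceForm K he)

/-- The homomorphism `Ae → D(A)e` which sends `z` to the linear form `x ↦ tr (e * x * z)`. -/
def toCornerRegularDual :
    (cornerFunctor he).obj (regular A) →ₗ[he.Cornerᵐᵒᵖ]
      (cornerFunctor he).obj (regularDual K A) where
  toFun z := ⟨(formOfRegular K A).symm (t.tr ∘ₗ LinearMap.mulLeft K e ∘ₗ LinearMap.mulRight K z.1),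
    regularDual_ext fun x => by
      change t.tr (e * (e * x * z.1)) = t.tr (e * (x * z.1))
      rw [← mul_assoc, ← mul_assoc, he.eq, mul_assoc]⟩
  map_add' z z' := Subtype.ext <| regularDual_ext fun x => by
    change t.tr (e * (x * (z.1 + z'.1))) = t.tr (e * (x * z.1)) + t.tr (e * (x * z'.1))
    rw [mul_add, mul_add, map_add]
  map_smul' b z := Subtype.ext <| regularDual_ext fun x => by
    change t.tr (e * (x * (z.1 * b.unop.1))) = t.tr (e * (b.unop.1 * x * z.1))
    have comm := t.comm b.unop (mkCorner he (e * (x * z.1)) (by rw [← mul_assoc, he.eq])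
      (by rw [mul_assoc, mul_assoc, show z.1 * e = z.1 from z.2]))
    change t.tr (b.unop.1 * (e * (x * z.1))) = t.tr (e * (x * z.1) * b.unop.1) at comm
    rw [← mul_assoc b.unop.1 e, corner_right] at comm
    rw [mul_assoc b.unop.1, ← mul_assoc e b.unop.1, corner_left, comm, mul_assoc, mul_assoc]

theorem toCornerRegularDual_apply (z : cornerGroup he (regular A)) (x : A) :
    formOfRegular K A (t.toCornerRegularDual z : cornerGroup he (regularDual K A)).1 x =
      t.tr (e * (x * z.1)) := rfl

variable [Module.Finite K A]

theorem bijective_toCornerRegularDual : Function.Bijective t.toCornerRegularDual := by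
  constructor
  · refine (injective_iff_map_eq_zero _).2 fun (z : cornerGroup he (regular A)) hz => ?_
    refine Subtype.ext <| congrArg Subtype.val <|
      t.eq_zero_of_forall_Ae (z := ⟨z.1, z.2⟩) fun y => ?_
    have : formOfRegular K A (t.toCornerRegularDual z : cornerGroup he (regularDual K A)).1 y.1
      = 0 := by rw [hz]; rfl
    rwa [toCornerRegularDual_apply, ← mul_assoc, y.2] at this
  · intro (q : cornerGroup he (regularDual K A))
    obtain ⟨z, hz⟩ := t.exists_Ae
      (formOfRegular K A q.1 ∘ₗ (eA he).subtype.restrictScalars K)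
    refine ⟨(⟨z.1, z.2⟩ : cornerGroup he (regular A)), Subtype.ext (regularDual_ext fun x => ?_)⟩
    have hq : formOfRegular K A q.1 (e * x) = formOfRegular K A q.1 x :=
      congrArg (fun q => formOfRegular K A q x) q.2
    rw [toCornerRegularDual_apply, ← hq, ← mul_assoc]
    exact hz (op x • idemEA he)

/-- The isomorphism `Ae ≅ D(A)e` given by a trace form. -/
noncomputable def cornerRegularIso :
    (cornerFunctor he).obj (regular A) ≅ (cornerFunctor he).obj (regularDual K A) :=
  (LinearEquiv.ofBijective t.toCornerRegularDual t.bijective_toCornerRegularDual).toModuleIso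

theorem cornerRegularIso_hom_comp_map (a : A) :
    (t.cornerRegularIso).hom ≫ (cornerFunctor he).map (dualMulRight K a) =
      (cornerFunctor he).map (fromRegular (regular A) a) ≫ (t.cornerRegularIso).hom := by
  ext (z : cornerGroup he (regular A))
  refine Subtype.ext (regularDual_ext fun x => ?_)
  change t.tr (e * (x * a * z.1)) = t.tr (e * (x * (a * z.1)))
  rw [mul_assoc x]

end TraceForm

theorem bijective_fromRegular :
    Function.Bijective (fromRegular (regular A) : A → (regular A ⟶ regular A)) := by
  refine ⟨fun a b h => ?_, fun f => ⟨f.hom (1 : A), ?_⟩⟩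
  · have := congrArg (fun f => (f.hom (1 : A) : A)) h
    change a * 1 = b * 1 at this
    rwa [mul_one, mul_one] at this
  · exact ModuleCat.hom_ext (LinearMap.ext fun a => (regular_hom_apply f a).symm)

variable [Module.Finite K A]

theorem bijective_dualMulRight :
    Function.Bijective (dualMulRight K : A → (regularDual K A ⟶ regularDual K A)) := by
  have bij : HomBijective (dualOfLeftFunctor K A).rightOp (ModuleCat.of A A) (ModuleCat.of A A) :=
    homBijective_dualOfLeftFunctor _ _
  have bij_hom : Function.Bijective fun a : A =>
      (ModuleCat.ofHom (LinearMap.toSpanSingleton A A a) : ModuleCat.of A A ⟶ ModuleCat.of A A) :=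
    Function.bijective_iff_has_inverse.2 ⟨fun f => f.hom (1 : A), fun a => one_mul a,
      fun f => ModuleCat.hom_ext (LinearMap.ext_ring (one_mul (f.hom (1 : A))))⟩
  exact Quiver.Hom.opEquiv.symm.bijective.comp (bij.comp bij_hom)

theorem TraceForm.homBijective_regularDual (t : TraceForm K he)
    (hA : HomBijective (cornerFunctor he) (regular A) (regular A)) :
    HomBijective (cornerFunctor he) (regularDual K A) (regularDual K A) := by
  refine (Function.Bijective.of_comp_iff _ bijective_dualMulRight).1 ?_
  have conj : (cornerFunctor he).map ∘ dualMulRight K =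
      t.cornerRegularIso.conj ∘ (cornerFunctor he).map ∘ fromRegular (regular A) := by
    funext a
    exact (Iso.eq_inv_comp _).2 (t.cornerRegularIso_hom_comp_map a)
  rw [conj]
  exact t.cornerRegularIso.conj.bijective.comp (hA.comp bijective_fromRegular)

/-- The dual pair `(A, D(A))` for the functor `(-)e`. -/
noncomputable def TraceForm.dualPair (t : TraceForm K he)
    (hA : HomBijective (cornerFunctor he) (regular A) (regular A)) :
    DualPair (cornerFunctor he) (regular A) (regularDual K A) where
  isSeparator := isSeparator_regular
  projective := inferInstance
  isCoseparator := isCoseparator_regularDual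
  injective := inferInstance
  homBijective_left := hA
  homBijective_right := t.homBijective_regularDual hA
  iso := t.cornerRegularIso

end RegularDual

section PowEA

open scoped ModuleCat

variable {A : Type u} [Ring A] {e : A} {he : IsIdempotentElem e}

/-- The right module `(eA)^k`. -/
abbrev powEA (he : IsIdempotentElem e) (k : ℕ) : ModuleCat.{u} Aᵐᵒᵖ :=
  ModuleCat.of Aᵐᵒᵖ (Fin k → eA he)

variable (he) in
/-- The finite powers of `eA`, which approximate the finitely generated modules. -/
def IsPowEA : ObjectProperty (ModuleCat.{u} Aᵐᵒᵖ) := fun X => ∃ k, X = powEA he k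

variable (A) in
/-- The finitely generated right modules. -/
def IsFinite : ObjectProperty (ModuleCat.{u} Aᵐᵒᵖ) := fun X => Module.Finite Aᵐᵒᵖ X

theorem homBijective_from_powEA (k : ℕ) (M : ModuleCat.{u} Aᵐᵒᵖ) :
    HomBijective (cornerFunctor he) (powEA he k) M := by
  let E (_ : Fin k) : ModuleCat.{u} Aᵐᵒᵖ := ModuleCat.of Aᵐᵒᵖ (eA he)
  have : HomBijective (cornerFunctor he) (⨁ E) M :=
    .of_isColimit (Limits.biproduct.isColimit E)
      (Limits.isColimitOfPreserves _ (Limits.biproduct.isColimit E)) fun _ => homBijective_from_eA M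
  exact this.of_iso_left (ModuleCat.biproductIsoPi E)

variable {K : Type u} [Field K] [Algebra K A]

theorem TraceForm.exists_hom_eA (t : TraceForm K he) (M : ModuleCat.{u} Aᵐᵒᵖ) (f : M →ₗ[K] K) :
    ∃ g : M ⟶ ModuleCat.of Aᵐᵒᵖ (eA he), ∀ m (z : Ae he),
      t.tr ((g.hom m : eA he).1 * z.1) = f (op z.1 • m) := by
  choose y hy using fun m : M => t.exists_eA
    (f ∘ₗ (LinearMap.toSpanSingleton Aᵐᵒᵖ M m).restrictScalars K ∘ₗ
      (opLinearEquiv K).toLinearMap ∘ₗ (Ae he).subtype.restrictScalars K)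
  have ext_tr {y y' : eA he} (h : ∀ z : Ae he, t.tr (y.1 * z.1) = t.tr (y'.1 * z.1)) : y = y' :=
    t.bijective_mulPairing.1 (LinearMap.ext h)
  refine ⟨ModuleCat.ofHom
    { toFun := y
      map_add' := fun m m' => ext_tr fun z => ?_
      map_smul' := fun a m => ext_tr fun z => ?_ }, hy⟩
  · change _ = t.tr (((y m).1 + (y m').1) * z.1)
    rw [add_mul, map_add, hy, hy, hy]
    exact (congrArg f (smul_add (op z.1) m m')).trans (map_add f _ _)
  · change _ = t.tr ((y m).1 * a.unop * z.1)
    rw [hy, mul_assoc]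
    exact (congrArg f (smul_smul (op z.1) a m)).trans (hy m (a.unop • z)).symm

section Finite

variable [Module.Finite K A] (M : ModuleCat.{u} Aᵐᵒᵖ) [Module.Finite Aᵐᵒᵖ M]

variable (K) in
include K in
theorem exists_epi_map_powEA :
    ∃ (k : ℕ) (π : powEA he k ⟶ M), Epi ((cornerFunctor he).map π) := by
  have : Module.Finite K M := finite_of_finite K M
  let b := Module.finBasis K M
  let π : powEA he (Module.finrank K M) ⟶ M :=
    ModuleCat.ofHom (∑ i, (fromEA M (b i)).hom ∘ₗ LinearMap.proj i)
  refine ⟨_, π, (ModuleCat.epi_iff_surjective _).2 fun (m : cornerGroup he M) => ?_⟩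
  let y : cornerGroup he (powEA he (Module.finrank K M)) :=
    ⟨fun i => b.repr m.1 i • idemEA he, funext fun i => Subtype.ext <| by
      change b.repr m.1 i • e * e = b.repr m.1 i • e
      rw [smul_mul_assoc, he.eq]⟩
  refine ⟨y, Subtype.ext ?_⟩
  calc π.hom y.1 = ∑ i, op (b.repr m.1 i • e) • b i := LinearMap.sum_apply _ _ _
    _ = ∑ i, op e • b.repr m.1 i • b i := Finset.sum_congr rfl fun i _ => by
      rw [op_smul, smul_assoc, smul_comm]
    _ = m.1 := by rw [← Finset.smul_sum, b.sum_repr, m.2]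

theorem TraceForm.exists_mono_map_powEA (t : TraceForm K he) :
    ∃ (k : ℕ) (j : M ⟶ powEA he k), Mono ((cornerFunctor he).map j) := by
  have : Module.Finite K M := finite_of_finite K M
  let b := Module.finBasis K M
  choose g hg using fun i => t.exists_hom_eA M (b.coord i)
  let j : M ⟶ powEA he (Module.finrank K M) :=
    ModuleCat.ofHom (LinearMap.pi fun i => (g i).hom)
  refine ⟨_, j, (ModuleCat.mono_iff_injective _).2 <| (injective_iff_map_eq_zero _).2
    fun (m : cornerGroup he M) hm => Subtype.ext (b.forall_coord_eq_zero_iff.1 fun i => ?_)⟩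
  have g_eq_zero : (g i).hom m.1 = 0 := congrFun (congrArg Subtype.val hm) i
  calc b.coord i m.1 = b.coord i (op e • m.1) := congrArg _ m.2.symm
    _ = t.tr (((g i).hom m.1 : eA he).1 * e) := (hg i m.1 (idemAe he)).symm
    _ = 0 := by rw [g_eq_zero]; exact (congrArg t.tr (zero_mul e)).trans (map_zero _)

end Finite

variable [Module.Finite K A]

theorem exists_cover [Module.Finite Aᵐᵒᵖ (eA he)] {M : ModuleCat.{u} Aᵐᵒᵖ} (hM : IsFinite A M)
    (h : HomBijective (cornerFunctor he) M (regularDual K A)) :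
    ∃ S : ShortComplex (ModuleCat.{u} Aᵐᵒᵖ), S.ShortExact ∧ S.X₃ = M ∧ IsPowEA he S.X₂ ∧
      IsFinite A S.X₁ := by
  have : Module.Finite Aᵐᵒᵖ M := hM
  obtain ⟨k, π, hπ⟩ := exists_epi_map_powEA K (he := he) M
  have : Epi π := h.epi_of_epi_map isCoseparator_regularDual
  have : IsNoetherianRing Aᵐᵒᵖ := .of_finite K Aᵐᵒᵖ
  exact ⟨_, { exact := ShortComplex.exact_kernel π }, rfl, ⟨k, rfl⟩,
    Module.Finite.of_injective (Limits.kernel.ι π).hom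
      ((ModuleCat.mono_iff_injective _).1 inferInstance)⟩

theorem TraceForm.exists_cocover (t : TraceForm K he) [Module.Finite Aᵐᵒᵖ (eA he)]
    {M : ModuleCat.{u} Aᵐᵒᵖ} (hM : IsFinite A M)
    (h : HomBijective (cornerFunctor he) (regular A) M) :
    ∃ S : ShortComplex (ModuleCat.{u} Aᵐᵒᵖ), S.ShortExact ∧ S.X₁ = M ∧ IsPowEA he S.X₂ ∧
      IsFinite A S.X₃ := by
  have : Module.Finite Aᵐᵒᵖ M := hM
  obtain ⟨k, j, hj⟩ := t.exists_mono_map_powEA M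
  have : Mono j := h.mono_of_mono_map isSeparator_regular
  exact ⟨_, { exact := ShortComplex.exact_cokernel j }, rfl, ⟨k, rfl⟩,
    Module.Finite.of_surjective (Limits.cokernel.π j).hom
      ((ModuleCat.epi_iff_surjective _).1 inferInstance)⟩

/-- The dual pair `(A, D(A))` of a gendo-symmetric algebra, with the powers of `eA` as
approximating projective-injective modules. -/
noncomputable def TraceForm.approximableDualPair (t : TraceForm K he)
    (hE : IsMinimalFaithfulProjInj (ModuleCat.of Aᵐᵒᵖ (eA he))) (hd : 2 ≤ domDim (regular A)) :
    ApproximableDualPair (cornerFunctor he) (regular A) (regularDual K A) (IsFinite A)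
      (IsPowEA he) :=
  have : Module.Finite Aᵐᵒᵖ (eA he) := hE.finite
  have : FaithfulSMul Aᵐᵒᵖ (eA he) := hE.faithful
  have : Module.Projective Aᵐᵒᵖ (eA he) := hE.projective
  have : Module.Injective Aᵐᵒᵖ (eA he) := hE.injective
  have module_projective (k : ℕ) : Module.Projective Aᵐᵒᵖ (powEA he k) :=
    .of_equiv (DFinsupp.linearEquivFunOnFintype (M := fun _ : Fin k => eA he))
  have module_injective (k : ℕ) : Module.Injective Aᵐᵒᵖ (powEA he k) := inferInstance
  have projective (k : ℕ) : Projective (powEA he k) :=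
    (IsProjective.iff_projective _).1 (module_projective k)
  have injective (k : ℕ) : Injective (powEA he k) :=
    (Module.injective_iff_injective_object _ _).1 (module_injective k)
  have bij_left (k : ℕ) : HomBijective (cornerFunctor he) (regular A) (powEA he k) :=
    t.homBijective_of_projective_of_injective _ _
  have := isIso_cornerAdjunctionG₁_unit (he := he)
  have := isIso_cornerAdjunctionG₂_counit (he := he)
  { toDualPair := t.dualPair (t.homBijective_of_domDim _ _ hd)
    projective_of := by rintro _ ⟨k, rfl⟩; exact projective k
    injective_of := by rintro _ ⟨k, rfl⟩; exact injective k
    homBijective_of_left := by rintro _ ⟨k, rfl⟩; exact bij_left k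
    homBijective_of_right := by rintro _ ⟨k, rfl⟩; exact homBijective_from_powEA k _
    projective_map := by
      rintro _ ⟨k, rfl⟩
      have := projective k
      exact projective_map_of_homBijective (cornerAdjunctionG₁ he)
        (isCoseparator_regularDual (K := K)) (homBijective_from_powEA k _)
    injective_map := by
      rintro _ ⟨k, rfl⟩
      have := injective k
      exact injective_map_of_homBijective (cornerAdjunctionG₂ he) isSeparator_regular (bij_left k)
    exists_cover := exists_cover
    exists_cocover := t.exists_cocover }

end PowEA

/-! ### Reflexive and Gorenstein projective modules -/

section LeftExact

variable {R S T : Type u} [Ring R] [Ring S] [AddCommGroup T] [Module R T] [Module S T]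
  [SMulCommClass R S T] {P₁ P₀ M : ModuleCat.{u} R} {f : P₁ →ₗ[R] P₀} {g : P₀ →ₗ[R] M}

theorem homDual_injective (hg : Function.Surjective g) : Function.Injective (homDual R S T g) :=
  fun _ _ h => LinearMap.cancel_right hg |>.1 h

theorem exact_homDual (hfg : Function.Exact f g) (hg : Function.Surjective g) :
    Function.Exact (homDual R S T g) (homDual R S T f) := by
  refine fun h => ⟨fun hh => ?_, ?_⟩
  · have hle : LinearMap.range f ≤ LinearMap.ker h := LinearMap.range_le_ker_iff.2 hh
    refine ⟨(LinearMap.range f).liftQ h hle ∘ₗ (hfg.linearEquivOfSurjective hg).symm.toLinearMap,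
      LinearMap.ext fun x => ?_⟩
    exact congrArg ((LinearMap.range f).liftQ h hle) (hfg.linearEquivOfSurjective_symm_apply hg x)
  · rintro ⟨k, rfl⟩
    exact (congrArg (k ∘ₗ ·) hfg.linearMap_comp_eq_zero).trans k.comp_zero

end LeftExact

section Reflexive

variable {R S T : Type u} [Ring R] [Ring S] [AddCommGroup T] [Module R T] [Module S T]

variable (R S) in
/-- The bimodule `T` is freely generated by `t` over `R` as well as over `S`. -/
structure IsFreeGenerator (t : T) : Prop where
  left : Function.Bijective fun r : R => r • t
  right : Function.Bijective fun s : S => s • t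

namespace IsFreeGenerator

variable {t : T} (ht : IsFreeGenerator R S t)

include ht in
theorem symm : IsFreeGenerator S R t := ⟨ht.right, ht.left⟩

/-- The isomorphism `R → T` mapping `1` to the free generator. -/
noncomputable def equiv : R ≃ₗ[R] T :=
  .ofBijective (LinearMap.toSpanSingleton R T t) ht.left

variable [SMulCommClass R S T]

/-- The isomorphism from `S ^ n` to the `T`-dual of `R ^ n`. -/
noncomputable def powEquiv (n : ℕ) : (Fin n → S) ≃ₗ[S] ((Fin n → R) →ₗ[R] T) :=
  .piCongrRight (fun _ => ht.symm.equiv) ≪≫ₗ (Pi.basisFun R (Fin n)).constr S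

theorem powEquiv_single (n : ℕ) (j : Fin n) (x : Fin n → R) :
    ht.powEquiv n (Pi.single j 1) x = x j • t := by
  refine ((Pi.basisFun R (Fin n)).constr_apply_fintype S _ x).trans ?_
  refine (Finset.sum_eq_single_of_mem j (Finset.mem_univ j) fun i _ hi => ?_).trans ?_
  · exact congrArg (x i • ht.symm.equiv ·) (Pi.single_eq_of_ne hi 1) |>.trans
      (by rw [map_zero, smul_zero])
  · exact congrArg (x j • ht.symm.equiv ·) (Pi.single_eq_same j 1) |>.trans
      (congrArg (x j • ·) (one_smul S t))

end IsFreeGenerator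

variable [SMulCommClass R S T]

variable (R S T) in
/-- `M` is reflexive: every homomorphism `Hom(M, T) → T` is the evaluation at a unique element of
`M`. -/
def IsReflexive (M : ModuleCat.{u} R) : Prop :=
  Function.Bijective (LinearMap.applyₗ' S : M →+ (M →ₗ[R] T) →ₗ[S] T)

theorem IsFreeGenerator.isReflexive_pow {t : T} (ht : IsFreeGenerator R S t) (n : ℕ) :
    IsReflexive R S T (ModuleCat.of R (Fin n → R)) := by
  constructor
  · intro x y hxy
    refine funext fun j => ht.left.1 ?_
    have h := LinearMap.congr_fun hxy (ht.powEquiv n (Pi.single j 1))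
    exact (ht.powEquiv_single n j x).symm.trans (h.trans (ht.powEquiv_single n j y))
  · intro φ
    choose x hx using fun j => ht.left.2 (φ (ht.powEquiv n (Pi.single j 1)))
    refine ⟨x, (LinearMap.cancel_right (ht.powEquiv n).surjective).1 ?_⟩
    exact LinearMap.pi_ext' fun j => LinearMap.ext_ring ((ht.powEquiv_single n j x).trans (hx j))

theorem IsReflexive.retract {M N : ModuleCat.{u} R} (hM : IsReflexive R S T M) (r : Retract N M) :
    IsReflexive R S T N := by
  have hr (x : N) : r.r.hom (r.i.hom x) = x := congrArg (fun k => k.hom x) r.retract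
  constructor
  · intro x y hxy
    rw [← hr x, ← hr y]
    refine congrArg r.r.hom (hM.1 (LinearMap.ext fun k => ?_))
    exact LinearMap.congr_fun hxy (k ∘ₗ r.i.hom)
  · intro φ
    obtain ⟨m, hm⟩ := hM.2 (φ ∘ₗ homDual R S T r.i.hom)
    refine ⟨r.r.hom m, LinearMap.ext fun k => ?_⟩
    refine (LinearMap.congr_fun hm (k ∘ₗ r.r.hom)).trans (congrArg φ (LinearMap.ext fun x => ?_))
    exact congrArg k (hr x)

variable (R) in
theorem exists_retract_pow (P : ModuleCat.{u} R) [Module.Finite R P] [Module.Projective R P] :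
    ∃ n : ℕ, Nonempty (Retract P (ModuleCat.of R (Fin n → R))) := by
  obtain ⟨n, p, i, -, -, hpi⟩ := Module.Finite.exists_comp_eq_id_of_projective R P
  exact ⟨n, ⟨⟨ModuleCat.ofHom i, ModuleCat.ofHom p, ModuleCat.hom_ext hpi⟩⟩⟩

section Projective

variable (S) {t : T} (ht : IsFreeGenerator R S t) (P : ModuleCat.{u} R) [Module.Finite R P]
  [Module.Projective R P]

include ht

theorem IsFreeGenerator.isReflexive : IsReflexive R S T P := by
  obtain ⟨n, ⟨r⟩⟩ := exists_retract_pow R P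
  exact (ht.isReflexive_pow n).retract r

theorem IsFreeGenerator.exists_retract_dual :
    ∃ n : ℕ, Nonempty (Retract (ModuleCat.of S (P →ₗ[R] T)) (ModuleCat.of S (Fin n → S))) := by
  obtain ⟨n, ⟨r⟩⟩ := exists_retract_pow R P
  refine ⟨n, ⟨.trans ⟨ModuleCat.ofHom (homDual R S T r.r.hom),
    ModuleCat.ofHom (homDual R S T r.i.hom), ?_⟩ (.ofIso (ht.powEquiv n).symm.toModuleIso)⟩⟩
  ext k x
  exact congrArg (fun l => k (l.hom x)) r.retract

theorem IsFreeGenerator.finite_dual : Module.Finite S (P →ₗ[R] T) := by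
  obtain ⟨n, ⟨r⟩⟩ := ht.exists_retract_dual S P
  exact .of_surjective r.r.hom ((ModuleCat.epi_iff_surjective _).1 inferInstance)

theorem IsFreeGenerator.projective_dual : Projective (ModuleCat.of S (P →ₗ[R] T)) := by
  obtain ⟨n, ⟨r⟩⟩ := ht.exists_retract_dual S P
  have : Projective (ModuleCat.of S (Fin n → S)) :=
    (IsProjective.iff_projective (Fin n → S)).1 inferInstance
  exact r.projective

end Projective

end Reflexive

section Gorenstein

variable {R S T : Type u} [Ring R] [Ring S] [AddCommGroup T] [Module R T] [Module S T]
  {t : T} (ht : IsFreeGenerator R S t)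

theorem extends_shortComplexOfCompEqZero_iff {X₁ X₂ X₃ : Type u} [AddCommGroup X₁]
    [AddCommGroup X₂] [AddCommGroup X₃] [Module R X₁] [Module R X₂] [Module R X₃]
    {f : X₁ →ₗ[R] X₂} {g : X₂ →ₗ[R] X₃} (h : g ∘ₗ f = 0) :
    Extends (ModuleCat.shortComplexOfCompEqZero f g h) (ModuleCat.of R T) ↔
      ∀ φ : X₁ →ₗ[R] T, ∃ χ : X₂ →ₗ[R] T, χ ∘ₗ f = φ := by
  constructor
  · intro hE φ
    obtain ⟨χ, hχ⟩ := hE (ModuleCat.ofHom φ)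
    exact ⟨χ.hom, congrArg ModuleCat.Hom.hom hχ⟩
  · intro hE φ
    obtain ⟨χ, hχ⟩ := hE φ.hom
    exact ⟨ModuleCat.ofHom χ, ModuleCat.hom_ext hχ⟩

variable [SMulCommClass R S T]

section Presentation

variable {P₁ P₀ M : ModuleCat.{u} R} {f : P₁ →ₗ[R] P₀} {g : P₀ →ₗ[R] M}

theorem forall_extends_homDual_iff (hg : Function.Surjective g)
    (hP₀ : Function.Surjective (LinearMap.applyₗ' S : P₀ →+ (P₀ →ₗ[R] T) →ₗ[S] T)) :
    (∀ φ : (M →ₗ[R] T) →ₗ[S] T, ∃ χ : (P₀ →ₗ[R] T) →ₗ[S] T, χ ∘ₗ homDual R S T g = φ) ↔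
      Function.Surjective (LinearMap.applyₗ' S : M →+ (M →ₗ[R] T) →ₗ[S] T) := by
  constructor
  · intro h φ
    obtain ⟨χ, rfl⟩ := h φ
    obtain ⟨p, rfl⟩ := hP₀ χ
    exact ⟨g p, rfl⟩
  · intro h φ
    obtain ⟨m, rfl⟩ := h φ
    obtain ⟨p, rfl⟩ := hg m
    exact ⟨LinearMap.applyₗ' S p, rfl⟩

theorem forall_extends_subtype_range_homDual_iff (hfg : Function.Exact f g)
    (hg : Function.Surjective g) (hP₁ : IsReflexive R S T P₁) (hP₀ : IsReflexive R S T P₀) :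
    (∀ φ : LinearMap.range (homDual R S T f) →ₗ[S] T,
        ∃ χ : (P₁ →ₗ[R] T) →ₗ[S] T, χ ∘ₗ (LinearMap.range (homDual R S T f)).subtype = φ) ↔
      Function.Injective (LinearMap.applyₗ' S : M →+ (M →ₗ[R] T) →ₗ[S] T) := by
  have hd := exact_homDual (S := S) (T := T) hfg hg
  constructor
  · refine fun h => (injective_iff_map_eq_zero _).2 fun m hm => ?_
    obtain ⟨p, rfl⟩ := hg m
    have hp : LinearMap.ker (homDual R S T f) ≤
        LinearMap.ker (LinearMap.applyₗ' S p : (P₀ →ₗ[R] T) →ₗ[S] T) := fun k hk => by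
      obtain ⟨l, rfl⟩ := (hd k).1 hk
      exact LinearMap.congr_fun hm l
    obtain ⟨χ, hχ⟩ := h ((LinearMap.ker _).liftQ _ hp ∘ₗ
      (homDual R S T f).quotKerEquivRange.symm.toLinearMap)
    obtain ⟨q, rfl⟩ := hP₁.2 χ
    have hqp : f q = p := hP₀.1 <| LinearMap.ext fun k =>
      (LinearMap.congr_fun hχ ⟨homDual R S T f k, k, rfl⟩).trans
        (congrArg ((LinearMap.ker _).liftQ _ hp)
          ((homDual R S T f).quotKerEquivRange_symm_apply_image k _))
    rw [← hqp, hfg.apply_apply_eq_zero]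
  · intro h φ
    obtain ⟨p, hp⟩ := hP₀.2 (φ ∘ₗ (homDual R S T f).rangeRestrict)
    have hgp : g p = 0 := (injective_iff_map_eq_zero _).1 h _ <| LinearMap.ext fun l => by
      have hl : (homDual R S T f).rangeRestrict (homDual R S T g l) = 0 :=
        Subtype.ext (hd.apply_apply_eq_zero l)
      exact (LinearMap.congr_fun hp (homDual R S T g l)).trans ((congrArg φ hl).trans (map_zero φ))
    obtain ⟨q, rfl⟩ := (hfg p).1 hgp
    refine ⟨LinearMap.applyₗ' S q, LinearMap.ext ?_⟩
    rintro ⟨_, k, rfl⟩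
    exact LinearMap.congr_fun hp k

variable [Module.Finite R P₁] [Module.Projective R P₁] [Module.Finite R P₀] [Module.Projective R P₀]

include ht

/-- Cut `0 → M* → P₀* → P₁* → Tr M → 0` at the image of `P₀* → P₁*`: the maps to `T` extend along
the left half iff `M → M**` is surjective and along the right half iff it is injective. -/
theorem extVanish_transpose_iff (hfg : Function.Exact f g) (hg : Function.Surjective g) :
    ExtVanish (ModuleCat.of S ((P₁ →ₗ[R] T) ⧸ LinearMap.range (homDual R S T f)))
        (ModuleCat.of S T) ↔
      IsReflexive R S T M ∧ ExtVanish (ModuleCat.of S (M →ₗ[R] T)) (ModuleCat.of S T) := by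
  let f' := homDual R S T f
  have hd := exact_homDual (S := S) (T := T) hfg hg
  have exact_range : Function.Exact (homDual R S T g) f'.rangeRestrict :=
    (Function.Injective.comp_exact_iff_exact Subtype.val_injective
      (i := (LinearMap.range f').subtype)).1 hd
  let U := ModuleCat.shortComplexOfCompEqZero _ _
    (LinearMap.exact_subtype_mkQ (LinearMap.range f')).linearMap_comp_eq_zero
  have hU : U.ShortExact := ModuleCat.shortComplex_shortExact _ (LinearMap.exact_subtype_mkQ _)
    Subtype.val_injective (Submodule.mkQ_surjective _)
  let V := ModuleCat.shortComplexOfCompEqZero _ _ exact_range.linearMap_comp_eq_zero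
  have hV : V.ShortExact := ModuleCat.shortComplex_shortExact _ exact_range (homDual_injective hg)
    f'.surjective_rangeRestrict
  have hP₁ : Projective U.X₂ := ht.projective_dual S P₁
  have hP₀ : Projective V.X₂ := ht.projective_dual S P₀
  have hU' : Extends U (ModuleCat.of S T) ↔ _ :=
    (extends_shortComplexOfCompEqZero_iff _).trans
      (forall_extends_subtype_range_homDual_iff hfg hg (ht.isReflexive S P₁) (ht.isReflexive S P₀))
  have hV' : Extends V (ModuleCat.of S T) ↔ _ :=
    (extends_shortComplexOfCompEqZero_iff _).trans
      (forall_extends_homDual_iff hg (ht.isReflexive S P₀).2)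
  refine (extVanish_left_iff hU (extVanish_of_projective _ _)).trans ?_
  rw [hU', IsReflexive, Function.Bijective, and_assoc, ← hV']
  exact and_congr_right' (extVanish_left_iff hV (extVanish_of_projective _ _))

end Presentation

include ht

theorem IsFreeGenerator.isReflexive_of_gorensteinProjective {M : ModuleCat.{u} R}
    (hM : gorensteinProjective R S T M) : IsReflexive R S T M := by
  obtain ⟨-, N, ⟨P₁, P₀, f, g, _, _, _, _, hfg, hg, ⟨i⟩⟩, -, hN⟩ := hM
  exact ((extVanish_transpose_iff ht hfg hg).1 (ExtVanish.of_iso_left hN i)).1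

theorem IsFreeGenerator.finite_dual_of_finite [IsNoetherianRing S] (M : ModuleCat.{u} R)
    [Module.Finite R M] : Module.Finite S (M →ₗ[R] T) := by
  obtain ⟨n, g, hg⟩ := Module.Finite.exists_fin' R M
  have := ht.finite_dual S (ModuleCat.of R (Fin n → R))
  exact .of_injective (homDual R S T (M := ModuleCat.of R (Fin n → R)) g) (homDual_injective hg)

theorem gorensteinProjective_of_isReflexive {M : ModuleCat.{u} R} [Module.FinitePresentation R M]
    (hE : ExtVanish M (ModuleCat.of R T)) (hM : IsReflexive R S T M)
    (hE' : ExtVanish (ModuleCat.of S (M →ₗ[R] T)) (ModuleCat.of S T)) :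
    gorensteinProjective R S T M := by
  obtain ⟨n, k, g, f, hg, hfg⟩ := Module.FinitePresentation.exists_fin' R M
  let P (n : ℕ) : ModuleCat.{u} R := ModuleCat.of R (Fin n → R)
  let f : P k →ₗ[R] P n := f
  have hP (n : ℕ) : Module.Finite R (P n) ∧ Module.Projective R (P n) :=
    ⟨inferInstanceAs (Module.Finite R (Fin n → R)),
      inferInstanceAs (Module.Projective R (Fin n → R))⟩
  have := hP n
  have := ht.finite_dual S (ModuleCat.of R (Fin k → R))
  exact ⟨⟨inferInstance, hE⟩, _, ⟨P k, P n, f, g, (hP k).1, (hP k).2, (hP n).1, (hP n).2, hfg, hg,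
    ⟨Iso.refl _⟩⟩, inferInstanceAs (Module.Finite S ((P k →ₗ[R] T) ⧸ _)),
    (extVanish_transpose_iff ht hfg hg).2 ⟨hM, hE'⟩⟩

omit ht

variable (R T) in
/-- Each module in `c` is finitely generated, has no extensions by `T` and embeds into a finitely
generated projective module with cokernel in `c`. -/
structure IsCosyzygyClosed (c : ObjectProperty (ModuleCat.{u} R)) : Prop where
  finite (M : ModuleCat.{u} R) : c M → Module.Finite R M
  extVanish (M : ModuleCat.{u} R) : c M → ExtVanish M (ModuleCat.of R T)
  exists_cosyzygy (M : ModuleCat.{u} R) : c M → ∃ X : ShortComplex (ModuleCat.{u} R),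
    X.ShortExact ∧ X.X₁ = M ∧ Module.Finite R X.X₂ ∧ Module.Projective R X.X₂ ∧ c X.X₃

namespace IsCosyzygyClosed

variable {c : ObjectProperty (ModuleCat.{u} R)} (hc : IsCosyzygyClosed R T c)

include hc

omit [SMulCommClass R S T] [Module S T] [Ring S] in
theorem exists_extension {X : ShortComplex (ModuleCat.{u} R)} (hX : X.ShortExact)
    [Module.Projective R X.X₂] (h₃ : c X.X₃) (k : X.X₁ →ₗ[R] T) :
    ∃ l : X.X₂ →ₗ[R] T, l ∘ₗ X.f.hom = k := by
  have : Projective X.X₂ := (IsProjective.iff_projective X.X₂).1 inferInstance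
  obtain ⟨l, hl⟩ := ((extVanish_left_iff hX (extVanish_of_projective _ _)).1
    (hc.extVanish _ h₃)).1 (ModuleCat.ofHom k)
  exact ⟨l.hom, congrArg ModuleCat.Hom.hom hl⟩

include ht

theorem injective_eval {M : ModuleCat.{u} R} (hM : c M) :
    Function.Injective (LinearMap.applyₗ' S : M →+ (M →ₗ[R] T) →ₗ[S] T) := by
  obtain ⟨X, hX, rfl, _, _, -⟩ := hc.exists_cosyzygy M hM
  intro m m' h
  refine (ModuleCat.mono_iff_injective _).1 hX.mono_f ((ht.isReflexive S X.X₂).1 ?_)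
  exact LinearMap.ext fun k => LinearMap.congr_fun h (k ∘ₗ X.f.hom)

theorem isReflexive {M : ModuleCat.{u} R} (hM : c M) : IsReflexive R S T M := by
  refine ⟨hc.injective_eval ht hM, fun φ => ?_⟩
  obtain ⟨X, hX, rfl, _, _, h₃⟩ := hc.exists_cosyzygy M hM
  have hE := (ShortComplex.ShortExact.moduleCat_exact_iff_function_exact _).1 hX.exact
  obtain ⟨p, hp⟩ := (ht.isReflexive S X.X₂).2 (φ ∘ₗ homDual R S T X.f.hom)
  have hgp : X.g.hom p = 0 := by
    refine (injective_iff_map_eq_zero _).1 (hc.injective_eval (S := S) ht h₃) _ ?_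
    refine LinearMap.ext fun k => ?_
    have hk : homDual R S T X.f.hom (homDual R S T X.g.hom k) = 0 :=
      LinearMap.ext fun x => (congrArg k (hE.apply_apply_eq_zero x)).trans (map_zero k)
    exact (LinearMap.congr_fun hp _).trans ((congrArg φ hk).trans (map_zero φ))
  obtain ⟨m, rfl⟩ := (hE p).1 hgp
  refine ⟨m, LinearMap.ext fun k => ?_⟩
  obtain ⟨l, rfl⟩ := hc.exists_extension hX h₃ k
  exact LinearMap.congr_fun hp l

theorem extVanish_dual {M : ModuleCat.{u} R} (hM : c M) :
    ExtVanish (ModuleCat.of S (M →ₗ[R] T)) (ModuleCat.of S T) := by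
  refine extVanish_of_syzygies
    (P := fun N => ∃ M, c M ∧ N = ModuleCat.of S (M →ₗ[R] T)) ?_ ⟨M, hM, rfl⟩
  rintro _ ⟨M, hM, rfl⟩
  obtain ⟨X, hX, rfl, _, _, h₃⟩ := hc.exists_cosyzygy M hM
  have hg := (ModuleCat.epi_iff_surjective _).1 hX.epi_g
  have hd := exact_homDual (S := S) (T := T)
    ((ShortComplex.ShortExact.moduleCat_exact_iff_function_exact _).1 hX.exact) hg
  have := ht.projective_dual S X.X₂
  exact ⟨ModuleCat.shortComplexOfCompEqZero _ _ hd.linearMap_comp_eq_zero,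
    ModuleCat.shortComplex_shortExact _ hd (homDual_injective hg) (hc.exists_extension hX h₃),
    extVanish_of_projective (ModuleCat.of S (X.X₂ →ₗ[R] T)) _,
    (extends_shortComplexOfCompEqZero_iff _).2
      ((forall_extends_homDual_iff hg (ht.isReflexive S X.X₂).2).2 (hc.isReflexive ht h₃).2),
    ⟨_, h₃, rfl⟩, rfl⟩

theorem gorensteinProjective [IsNoetherianRing R] {M : ModuleCat.{u} R} (hM : c M) :
    gorensteinProjective R S T M := by
  have := hc.finite M hM
  have := Module.finitePresentation_of_finite R M
  exact gorensteinProjective_of_isReflexive ht (hc.extVanish M hM) (hc.isReflexive ht hM)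
    (hc.extVanish_dual ht hM)

end IsCosyzygyClosed

end Gorenstein

section HomBijective

variable {R S T : Type u} [Ring R] [Ring S] [AddCommGroup T] [Module R T] [Module S T]
  {t : T} (ht : IsFreeGenerator R S t)

variable {D : Type*} [Category* D] [Preadditive D] {F : ModuleCat.{u} R ⥤ D} [F.Additive]
  {X : ModuleCat.{u} R} (h : HomBijective F X (ModuleCat.of R T))

include ht h

theorem HomBijective.of_finite_projective (P : ModuleCat.{u} R) [Module.Finite R P]
    [Module.Projective R P] : HomBijective F X P := by
  obtain ⟨n, ⟨r⟩⟩ := exists_retract_pow R P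
  let E (_ : Fin n) : ModuleCat.{u} R := ModuleCat.of R R
  have hE : HomBijective F X (⨁ E) :=
    .of_isLimit (Limits.biproduct.isLimit E)
      (Limits.isLimitOfPreserves _ (Limits.biproduct.isLimit E)) fun _ =>
        h.retract (.ofIso ht.equiv.toModuleIso)
  exact hE.retract (r.trans (.ofIso (ModuleCat.biproductIsoPi E).symm))

variable [SMulCommClass R S T]

/-- Dualizing a presentation of `M*` exhibits `M ≅ M**` as the kernel of a homomorphism between
finitely generated projective modules. -/
theorem HomBijective.of_isReflexive [F.PreservesMonomorphisms] {M : ModuleCat.{u} R}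
    (hM : IsReflexive R S T M) [Module.FinitePresentation S (M →ₗ[R] T)] :
    HomBijective F X M := by
  have := SMulCommClass.symm R S T
  obtain ⟨n, k, g, f, hg, hfg⟩ := Module.FinitePresentation.exists_fin' S (M →ₗ[R] T)
  let P (n : ℕ) : ModuleCat.{u} S := ModuleCat.of S (Fin n → S)
  let f' := homDual S R T (M := P k) (N := P n) f
  have hd := exact_homDual (R := S) (S := R) (T := T) (P₁ := P k) (P₀ := P n)
    (M := ModuleCat.of S (M →ₗ[R] T)) hfg hg
  have hdual (n : ℕ) : HomBijective F X (ModuleCat.of R (P n →ₗ[S] T)) := by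
    have hP : Module.Finite S (P n) ∧ Module.Projective S (P n) :=
      ⟨inferInstanceAs (Module.Finite S (Fin n → S)),
        inferInstanceAs (Module.Projective S (Fin n → S))⟩
    have := hP.1
    have := hP.2
    have := ht.symm.finite_dual R (P n)
    have := (IsProjective.iff_projective _).2 (ht.symm.projective_dual R (P n))
    exact h.of_finite_projective ht (ModuleCat.of R (P n →ₗ[S] T))
  have hgf : Function.Exact g.flip f' := fun y =>
    (hd y).trans (Set.ext_iff.1 (hM.2.range_comp _) y).symm
  have hinj : Function.Injective g.flip := (homDual_injective (R := S) (S := R)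
    (P₀ := P n) (M := ModuleCat.of S (M →ₗ[R] T)) hg).comp hM.1
  let U := ModuleCat.shortComplexOfCompEqZero _ _ hgf.linearMap_comp_eq_zero
  have : Mono U.f := (ModuleCat.mono_iff_injective _).2 hinj
  exact .of_kernel (S := U) ((ShortComplex.ShortExact.moduleCat_exact_iff_function_exact _).2 hgf)
    (hdual n) (hdual k)

end HomBijective

section Composition

variable {C D E : Type*} [Category* C] [Category* D] [Category* E] {F : C ⥤ D} {X Y : C}

theorem HomBijective.comp_iff {G : D ⥤ E} (h : HomBijective F X Y) :
    HomBijective (F ⋙ G) X Y ↔ HomBijective G (F.obj X) (F.obj Y) :=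
  Function.Bijective.of_comp_iff _ h

theorem projective_of_homBijective [F.PreservesEpimorphisms] (p : X ⟶ Y) [Epi p] [Projective X]
    [Projective (F.obj Y)] (hX : HomBijective F Y X) (hY : HomBijective F Y Y) :
    Projective Y := by
  obtain ⟨s, hs⟩ := hX.2 (Projective.factorThru (𝟙 _) (F.map p))
  refine (Retract.mk s p (hY.1 ?_)).projective
  rw [F.map_comp, hs, Projective.factorThru_comp, F.map_id]

end Composition

theorem isFreeGenerator_regular (A : Type u) [Ring A] : IsFreeGenerator A Aᵐᵒᵖ (1 : A) where
  left := ⟨fun a b h => by simpa using h, fun x => ⟨x, mul_one x⟩⟩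
  right := ⟨fun a b h => by simpa using h, fun x => ⟨op x, one_mul x⟩⟩

section Gorenstein

variable {K A : Type u} [Field K] [Ring A] [Algebra K A] [Module.Finite K A] {e : A}
  {he : IsIdempotentElem e}

include K in
theorem homBijective_of_gp (h : HomBijective (cornerFunctor he) (regular A) (regular A))
    {M : ModuleCat.{u} Aᵐᵒᵖ} (hM : Gp A M) : HomBijective (cornerFunctor he) (regular A) M := by
  have : IsNoetherianRing A := .of_finite K A
  have ht := (isFreeGenerator_regular A).symm
  have := hM.1.1
  have := ht.finite_dual_of_finite M
  have := Module.finitePresentation_of_finite A (M →ₗ[Aᵐᵒᵖ] A)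
  exact h.of_isReflexive ht (ht.isReflexive_of_gorensteinProjective hM)

theorem homBijective_of_gi
    (h : HomBijective (cornerFunctor he) (regularDual K A) (regularDual K A))
    {M : ModuleCat.{u} Aᵐᵒᵖ} (hM : Gi K A M) :
    HomBijective (cornerFunctor he) M (regularDual K A) := by
  have : IsNoetherianRing Aᵐᵒᵖ := .of_finite K Aᵐᵒᵖ
  have ht := isFreeGenerator_regular A
  have := hM.1
  have := finite_dualOfRight (K := K) M
  have := ht.finite_dual_of_finite (dualOfRight K A M)
  have := Module.finitePresentation_of_finite Aᵐᵒᵖ (dualOfRight K A M →ₗ[A] A)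
  let F := (dualOfLeftFunctor K A).rightOp ⋙ (cornerFunctor he).op
  have hF : HomBijective F (ModuleCat.of A A) (ModuleCat.of A A) :=
    (homBijective_dualOfLeftFunctor _ _).comp_iff.2 (homBijective_op_iff.2 h)
  have hD : HomBijective F (ModuleCat.of A A) (dualOfRight K A M) :=
    hF.of_isReflexive ht (ht.isReflexive_of_gorensteinProjective hM.2)
  exact (homBijective_op_iff.1 ((homBijective_dualOfLeftFunctor _ _).comp_iff.1 hD)).of_iso_left
    (bidualIso K M)

theorem extVanish_dualOfRight_iff (M : ModuleCat.{u} Aᵐᵒᵖ) [Module.Finite Aᵐᵒᵖ M] :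
    ExtVanish (dualOfRight K A M) (ModuleCat.of A A) ↔ ExtVanish (regularDual K A) M := by
  rw [← extVanish_dualOfLeft_iff K]
  exact ⟨fun h => h.of_iso_right (bidualIso K M), fun h => h.of_iso_right (bidualIso K M).symm⟩

theorem projective_dualOfRight (M : ModuleCat.{u} Aᵐᵒᵖ) [Module.Finite Aᵐᵒᵖ M] [Injective M] :
    Projective (dualOfRight K A M) := by
  have := finite_dualOfRight (K := K) M
  obtain ⟨n, g, hg⟩ := Module.Finite.exists_fin' A (dualOfRight K A M)
  let P : ModuleCat.{u} A := ModuleCat.of A (Fin n → A)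
  let p : P ⟶ dualOfRight K A M := ModuleCat.ofHom (X := P) (Y := dualOfRight K A M) g
  have : Module.Finite A P := inferInstanceAs (Module.Finite A (Fin n → A))
  have : Projective P := (IsProjective.iff_projective (Fin n → A)).1 inferInstance
  have : Epi p := (ModuleCat.epi_iff_surjective _).2 hg
  have : Injective (dualOfLeft K A (dualOfRight K A M)) := .of_iso (bidualIso K M).symm ‹_›
  have : Projective ((dualOfLeftFunctor K A).rightOp.obj (dualOfRight K A M)) :=
    inferInstanceAs (Projective (Opposite.op (dualOfLeft K A (dualOfRight K A M))))
  have := (dualAdjunction K A).isLeftAdjoint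
  exact projective_of_homBijective p (homBijective_dualOfLeftFunctor (K := K) _ P)
    (homBijective_dualOfLeftFunctor _ _)

end Gorenstein

/-! ### The equivalences -/

section Equivalence

variable {K A : Type u} [Field K] [Ring A] [Algebra K A] [Module.Finite K A] {e : A}
  {he : IsIdempotentElem e}

theorem finite_of_isPowEA [Module.Finite Aᵐᵒᵖ (eA he)] {X : ModuleCat.{u} Aᵐᵒᵖ}
    (hX : IsPowEA he X) : Module.Finite Aᵐᵒᵖ X := by
  obtain ⟨k, rfl⟩ := hX
  exact inferInstanceAs (Module.Finite Aᵐᵒᵖ (Fin k → eA he))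

/-- `(-)e` maps the regular module to `Ae`. -/
def cornerRegularIsoAe : (cornerFunctor he).obj (regular A) ≅ AeCorner he :=
  let φ : (cornerFunctor he).obj (regular A) ≃ₗ[he.Cornerᵐᵒᵖ] AeCorner he :=
    { toFun := fun z => (⟨z.1, z.2⟩ : Ae he)
      invFun := fun z => (⟨z.1, z.2⟩ : cornerGroup he (regular A))
      map_add' := fun _ _ => rfl
      map_smul' := fun _ _ => rfl }
  φ.toModuleIso

section Perp

variable {R : Type u} [Ring R] (T : ModuleCat.{u} R)

instance : (leftPerp T).IsClosedUnderIsomorphisms where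
  of_iso i h :=
    have := h.1
    ⟨.equiv i.toLinearEquiv, ExtVanish.of_iso_left h.2 i⟩

instance : (rightPerp T).IsClosedUnderIsomorphisms where
  of_iso i h :=
    have := h.1
    ⟨.equiv i.toLinearEquiv, ExtVanish.of_iso_right h.2 i⟩

end Perp

variable (K he) in
/-- The modules `M` with `Ext^i(M, A) = 0 = Ext^i(D(A), M)` for `i ≥ 1` that are determined by
`Me`. -/
abbrev IsCornerBiperpendicular : ObjectProperty (ModuleCat.{u} Aᵐᵒᵖ) :=
  IsBiperpendicular (cornerFunctor he) (regular A) (regularDual K A) (IsFinite A)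

variable (p : ApproximableDualPair (cornerFunctor he) (regular A) (regularDual K A) (IsFinite A)
  (IsPowEA he))

include p

theorem leftPerp_map_iff {M : ModuleCat.{u} Aᵐᵒᵖ} [Module.Finite Aᵐᵒᵖ M]
    (h : HomBijective (cornerFunctor he) M (regularDual K A)) :
    leftPerp (AeCorner he) ((cornerFunctor he).obj M) ↔ ExtVanish M (regular A) := by
  rw [← p.extVanish_map_left_iff ‹_› h]
  exact ⟨fun H => ExtVanish.of_iso_right H.2 cornerRegularIsoAe.symm,
    fun H => ⟨finite_cornerFunctor K he M, H.of_iso_right cornerRegularIsoAe⟩⟩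

theorem rightPerp_map_iff {M : ModuleCat.{u} Aᵐᵒᵖ} [Module.Finite Aᵐᵒᵖ M]
    (h : HomBijective (cornerFunctor he) (regular A) M) :
    rightPerp (AeCorner he) ((cornerFunctor he).obj M) ↔ ExtVanish (regularDual K A) M := by
  rw [← p.extVanish_map_right_iff ‹_› h]
  have i := p.iso.symm ≪≫ cornerRegularIsoAe
  exact ⟨fun H => ExtVanish.of_iso_left H.2 i.symm,
    fun H => ⟨finite_cornerFunctor K he M, H.of_iso_left i⟩⟩

theorem isBiperpendicular_of_gpi {M : ModuleCat.{u} Aᵐᵒᵖ} (hM : Gpi K A M) :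
    IsCornerBiperpendicular K he M where
  fin := hM.2.1
  homBijective_left := homBijective_of_gp (K := K) p.homBijective_left hM.1
  homBijective_right := homBijective_of_gi p.homBijective_right hM.2
  extVanish_left := hM.1.1.2
  extVanish_right := have := hM.2.1; (extVanish_dualOfRight_iff M).1 hM.2.2.1.2

section IsCosyzygyClosed

variable [Module.Finite Aᵐᵒᵖ (eA he)]

omit [Module.Finite K A] in
theorem isCosyzygyClosed_isBiperpendicular :
    IsCosyzygyClosed Aᵐᵒᵖ A (IsCornerBiperpendicular K he) where
  finite _ hM := hM.fin
  extVanish _ hM := hM.extVanish_left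
  exists_cosyzygy _ hM := by
    obtain ⟨S, hS, h₁, h₂, h₃⟩ := p.exists_cosyzygy hM
    exact ⟨S, hS, h₁, finite_of_isPowEA h₂,
      (IsProjective.iff_projective S.X₂).2 (p.projective_of h₂), h₃⟩

theorem isCosyzygyClosed_dualOfRight :
    IsCosyzygyClosed A A fun N => ∃ M, IsCornerBiperpendicular K he M ∧ N = dualOfRight K A M where
  finite := by
    rintro _ ⟨M, hM, rfl⟩
    have : Module.Finite Aᵐᵒᵖ M := hM.fin
    exact finite_dualOfRight M
  extVanish := by
    rintro _ ⟨M, hM, rfl⟩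
    have : Module.Finite Aᵐᵒᵖ M := hM.fin
    exact (extVanish_dualOfRight_iff M).2 hM.extVanish_right
  exists_cosyzygy := by
    rintro _ ⟨M, hM, rfl⟩
    obtain ⟨S, hS, rfl, h₂, h₁⟩ := p.exists_syzygy hM
    have := finite_of_isPowEA h₂
    have := p.injective_of h₂
    exact ⟨_, shortExact_map_dualOfRightFunctor hS, rfl, finite_dualOfRight S.X₂,
      (IsProjective.iff_projective _).2 (projective_dualOfRight S.X₂), _, h₁, rfl⟩

theorem gpi_iff_isBiperpendicular {M : ModuleCat.{u} Aᵐᵒᵖ} :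
    Gpi K A M ↔ IsCornerBiperpendicular K he M := by
  have : IsNoetherianRing Aᵐᵒᵖ := .of_finite K Aᵐᵒᵖ
  have : IsNoetherianRing A := .of_finite K A
  have hA := isFreeGenerator_regular A
  exact ⟨isBiperpendicular_of_gpi p, fun hM =>
    ⟨(isCosyzygyClosed_isBiperpendicular p).gorensteinProjective hA.symm hM,
      hM.fin, (isCosyzygyClosed_dualOfRight p).gorensteinProjective hA ⟨M, hM, rfl⟩⟩⟩

end IsCosyzygyClosed

theorem w_map_of_isBiperpendicular {M : ModuleCat.{u} Aᵐᵒᵖ}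
    (h : IsCornerBiperpendicular K he M) : W he ((cornerFunctor he).obj M) := by
  have : Module.Finite Aᵐᵒᵖ M := h.fin
  obtain ⟨i⟩ := nonempty_G₁_iso isCoseparator_regularDual h.homBijective_right
  obtain ⟨j⟩ := nonempty_iso_G₂ h.homBijective_left
  exact ⟨⟨(leftPerp_map_iff p h.homBijective_right).2 h.extVanish_left,
    (rightPerp_map_iff p h.homBijective_left).2 h.extVanish_right⟩, ⟨i ≪≫ j⟩⟩

theorem isBiperpendicular_G₂_of_w {X : ModuleCat.{u} he.Cornerᵐᵒᵖ} (hX : W he X) :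
    IsCornerBiperpendicular K he (G₂ he X) := by
  obtain ⟨⟨hl, hr⟩, ⟨i⟩⟩ := hX
  have := hl.1
  have hf := finite_G₂ K he X
  have hA := homBijective_G₂ (regular A) X
  have hQ := (homBijective_G₁ X (regularDual K A)).of_iso_left i
  exact ⟨hf, hA, hQ, (leftPerp_map_iff p hQ).1 ((leftPerp _).prop_of_iso (cornerG₂Iso X).symm hl),
    (rightPerp_map_iff p hA).1 ((rightPerp _).prop_of_iso (cornerG₂Iso X).symm hr)⟩

section NearlyGorenstein

variable (hN : IsNearlyGorenstein K A) {X : ModuleCat.{u} he.Cornerᵐᵒᵖ}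

include hN

theorem isBiperpendicular_G₂_of_rightPerp (hX : rightPerp (AeCorner he) X) :
    IsCornerBiperpendicular K he (G₂ he X) := by
  have := hX.1
  have hf := finite_G₂ K he X
  have hA := homBijective_G₂ (regular A) X
  have hE := (rightPerp_map_iff p hA).1 ((rightPerp _).prop_of_iso (cornerG₂Iso X).symm hX)
  have homBijective (M : ModuleCat.{u} Aᵐᵒᵖ) (hM : IsFinite A M)
      (hE : ExtVanish (regularDual K A) M) :
      HomBijective (cornerFunctor he) M (regularDual K A) :=
    homBijective_of_gi p.homBijective_right (hN.right ▸ ⟨hM, hE⟩)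
  exact ⟨hf, hA, homBijective _ hf hE, p.extVanish_of_extVanish_right homBijective hf hA hE, hE⟩

theorem leftPerp_of_rightPerp (hX : rightPerp (AeCorner he) X) : leftPerp (AeCorner he) X :=
  have h := isBiperpendicular_G₂_of_rightPerp p hN hX
  (leftPerp _).prop_of_iso (cornerG₂Iso X) (w_map_of_isBiperpendicular p h).1.1

theorem rightPerp_of_leftPerp (hX : leftPerp (AeCorner he) X) : rightPerp (AeCorner he) X := by
  have := hX.1
  have hf := finite_G₁ X
  have hQ := homBijective_G₁ X (regularDual K A)
  have hE := (leftPerp_map_iff p hQ).1 ((leftPerp _).prop_of_iso (cornerG₁Iso X).symm hX)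
  have homBijective (M : ModuleCat.{u} Aᵐᵒᵖ) (hM : IsFinite A M)
      (hE : ExtVanish M (regular A)) : HomBijective (cornerFunctor he) (regular A) M :=
    homBijective_of_gp (K := K) p.homBijective_left (hN.left ▸ ⟨hM, hE⟩)
  exact (rightPerp _).prop_of_iso (cornerG₁Iso X) ((rightPerp_map_iff p (homBijective _ hf hE)).2
    (p.extVanish_of_extVanish_left homBijective hf hQ hE))

end NearlyGorenstein

variable [Module.Finite Aᵐᵒᵖ (eA he)]

theorem restrictsToEquivalence_of_isBiperpendicular
    {Q : ObjectProperty (ModuleCat.{u} he.Cornerᵐᵒᵖ)} (hQ : W he ≤ Q)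
    (hG : ∀ X, Q X → IsCornerBiperpendicular K he (G₂ he X)) :
    RestrictsToEquivalence (cornerFunctor he) (Gpi K A) Q :=
  restrictsToEquivalence_of_homBijective
    (fun _ hM => hQ _ (w_map_of_isBiperpendicular p (isBiperpendicular_of_gpi p hM)))
    (fun M _ _ hN => (isBiperpendicular_of_gpi p hN).homBijective_left.of_isSeparator
      isSeparator_regular M)
    fun X hX => ⟨_, (gpi_iff_isBiperpendicular p).2 (hG X hX), ⟨cornerG₂Iso X⟩⟩

end Equivalence

end GendoSym

theorem mainTheorem11_general {K A : Type u} [Field K] [Ring A] [Algebra K A] [Module.Finite K A]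
    (hA : GendoSym.IsGendoSymmetric K A) {e : A} (he : IsIdempotentElem e)
    (heA : GendoSym.IsMinimalFaithfulProjInj (ModuleCat.of Aᵐᵒᵖ (GendoSym.eA he))) :
    GendoSym.RestrictsToEquivalence (GendoSym.cornerFunctor he) (GendoSym.Gpi K A)
      (GendoSym.W he) ∧
    (GendoSym.IsNearlyGorenstein K A →
      GendoSym.RestrictsToEquivalence (GendoSym.cornerFunctor he) (GendoSym.Gpi K A)
        (GendoSym.rightPerp (GendoSym.AeCorner he)) ∧
      GendoSym.rightPerp (GendoSym.AeCorner he) = GendoSym.leftPerp (GendoSym.AeCorner he) ∧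
      GendoSym.leftPerp (GendoSym.AeCorner he) =
        GendoSym.leftPerp (GendoSym.AeCorner he) ⊓ GendoSym.rightPerp (GendoSym.AeCorner he)) := by
  obtain ⟨t⟩ := GendoSym.exists_traceForm hA heA
  have : Module.Finite Aᵐᵒᵖ (GendoSym.eA he) := heA.finite
  let p := t.approximableDualPair heA hA.1
  refine ⟨GendoSym.restrictsToEquivalence_of_isBiperpendicular p le_rfl fun _ hX =>
    GendoSym.isBiperpendicular_G₂_of_w p hX, fun hN => ?_⟩
  have hr : GendoSym.rightPerp (GendoSym.AeCorner he) ≤ GendoSym.leftPerp (GendoSym.AeCorner he) :=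
    fun _ hX => GendoSym.leftPerp_of_rightPerp p hN hX
  have hl : GendoSym.leftPerp (GendoSym.AeCorner he) ≤ GendoSym.rightPerp (GendoSym.AeCorner he) :=
    fun _ hX => GendoSym.rightPerp_of_leftPerp p hN hX
  exact ⟨GendoSym.restrictsToEquivalence_of_isBiperpendicular p (fun _ hX => hX.1.2) fun _ hX =>
    GendoSym.isBiperpendicular_G₂_of_rightPerp p hN hX, hr.antisymm hl, (inf_eq_left.2 hl).symm⟩

theorem mainTheorem11 {K A : Type u} [Field K] [Ring A] [Algebra K A] [Module.Finite K A]
    (hA : GendoSym.IsGendoSymmetric K A) {e : A} (he : IsIdempotentElem e)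
    (heA : GendoSym.IsMinimalFaithfulProjInj (ModuleCat.of Aᵐᵒᵖ (GendoSym.eA he))) :
    (¬ GendoSym.IsSelfinjective A →
      GendoSym.RestrictsToEquivalence (GendoSym.cornerFunctor he) (GendoSym.Gpi K A)
        (GendoSym.W he)) ∧
    (GendoSym.IsNearlyGorenstein K A →
      GendoSym.RestrictsToEquivalence (GendoSym.cornerFunctor he) (GendoSym.Gpi K A)
        (GendoSym.rightPerp (GendoSym.AeCorner he)) ∧
      GendoSym.rightPerp (GendoSym.AeCorner he) = GendoSym.leftPerp (GendoSym.AeCorner he) ∧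
      GendoSym.leftPerp (GendoSym.AeCorner he) =
        GendoSym.leftPerp (GendoSym.AeCorner he) ⊓ GendoSym.rightPerp (GendoSym.AeCorner he)) :=
  (mainTheorem11_general hA he heA).imp_left fun h _ => h
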